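/- Let $\mathfrak o$ be a complete discrete valuation ring with finite residue field, $\ell\in\mathbb N$, $\mathfrak o_\ell=\mathfrak o/\mathfrak p^\ell$, let $R$ be a finite (not necessarily commutative) $\mathfrak o_\ell$-algebra, and let $K$ be an algebraically closed field of characteristic $0$. Let $M=M_1^{a_1}\oplus\cdots\oplus M_n^{a_n}$, where $M_1,\dots,M_n$ are pairwise non-isomorphic finite indecomposable $R$-modules and all $a_i>0$, and let $V$ be an irreducible representation of $\operatorname{Aut}_R(M)$ over $K$. *Trivial functor morphing.* Let $\mathcal C$ be the full subcategory of $R$-modules isomorphic to $\bigoplus_i M_i^{b_i}$, $b_i\in\mathbb N$, and $\mathcal C_{+1}$ the category of $\mathfrak o_\ell$-linear functors $\mathcal C\to\mathfrak o_\ell\text{-Mod}$. For $F,G\in\mathcal C_{+1}$ write $G\prec F$ if $G$ is isomorphic to a subquotient of $F$ and $G\not\cong F$. Let $KF(M)$ be the permutation representation of $\operatorname{Aut}_R(M)$ with basis $F(M)$, and $\overline{KF(M)}$ its largest subrepresentation with $\operatorname{Hom}_{\operatorname{Aut}_R(M)}(KG(M),\overline{KF(M)})=0$ for all $G\prec F$.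 The functor morphing of $V$ is $(M,V)\leadsto(F,\widetilde V)$ if $\operatorname{Hom}_{\operatorname{Aut}_R(M)}(KF(M),V)\neq 0$, $\operatorname{Hom}_{\operatorname{Aut}_R(M)}(KG(M),V)=0$ for all $G\prec F$, and $\widetilde V\cong\operatorname{Hom}_{\operatorname{Aut}_R(M)}(\overline{KF(M)},V)$ as representations of $\operatorname{Aut}(F)$. It is trivial if $F=\operatorname{Hom}_R(M,-)$ and $\widetilde V\cong V$ under the Yoneda isomorphism $\operatorname{Aut}(F)\cong\operatorname{Aut}_R(M)$. *The left maximal graph.* A morphism $f:M_j\to M_i$ is left maximal if it is non-zero, not invertible, and $gf=0$ for every $k$ and every non-invertible $g:M_i\to M_k$. Let $E_i$ be the quotient of $\operatorname{End}_R(M_i)$ by its Jacobson radical (a finite field). The left maximal morphisms $M_j\to M_i$ together with $0$ form an $E_i$-vector space $LM(M_j,M_i)$. The directed graph $LM(M_1,\dots,M_n)$ has vertices $1,\dots,n$ and $\dim_{E_i}LM(M_j,M_i)$ arrows from $j$ to $i$. **Theorem.** Suppose that $V$ admits trivial functor morphing. Suppose moreover that (a) if $n=1$, then $\operatorname{End}_R(M_1)$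 is not a field (it contains a non-zero non-invertible element); (b) if the graph $LM(M_1,\dots,M_n)$ has an arrow between two distinct vertices, then it has such an arrow $j\to i$, $j\neq i$, with $(a_j,|E_j|)\neq(1,2)$. Then at least one of the following holds: 1. There is a splitting $M=M'\oplus M''$ with $M',M''\neq0$ and $\operatorname{Aut}_R(M)=\operatorname{Aut}_R(M')\times\operatorname{Aut}_R(M'')$, that is, every automorphism of $M$ is the direct sum of an automorphism of $M'$ and one of $M''$. 2. $V$ is induced from a proper subgroup of $\operatorname{Aut}_R(M)$ that is isomorphic to $\operatorname{Aut}_{\widetilde R}(\widetilde M)$. Here $\widetilde R=R\oplus (R\otimes_{\mathbb Z}R)$, with $b_1\otimes b_2$ written $b_1xb_2$ and product $(a+b_1xb_2)(c+d_1xd_2)=ac+ad_1xd_2+b_1xb_2c$; and $\widetilde M$ is $M$ as an $R$-module, with $x$ acting as follows. There are a cycle $v_0\to v_1\to\cdots\to v_k\to v_0$ of $k+1>1$ distinct vertices of $LM(M_1,\dots,M_n)$, with exactly one arrow from each vertex to the next and with $a_{v_0}=\cdots=a_{v_k}=:a$, and basis elements $f_p\in LM(M_{v_p},M_{v_{p+1}})$,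 $0\le p<k$, such that $x$ maps $(m_1,\dots,m_a)\in M_{v_p}^{a}$ to $(f_p(m_1),\dots,f_p(m_a))\in M_{v_{p+1}}^{a}$ for $p<k$ and is zero on all other summands $M_j^{a_j}$. 3. The graph $LM(M_1,\dots,M_n)$ is a disjoint union of single vertices, each with exactly one self-loop. -/

import Mathlib

open CategoryTheory

universe u v w

namespace FunctorMorphing

noncomputable section

/-! ### Modules -/

section Modules

variable {R : Type u} [Ring R] {ι : Type} (N : ι → Type v)
  [∀ i, AddCommGroup (N i)] [∀ i, Module R (N i)]

/-- A module is indecomposable if it is non-zero and is not the direct sum of two non-zero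
submodules. -/
def IsIndecomposable (R : Type u) [Ring R] (X : Type v) [AddCommGroup X] [Module R X] : Prop :=
  Nontrivial X ∧ ∀ P Q : Submodule R X, IsCompl P Q → P = ⊥ ∨ Q = ⊥

/-- The module `⨁ᵢ Nᵢ ^ aᵢ` (the index set is finite in all applications). -/
abbrev BigModule (a : ι → ℕ) : Type v := (i : ι) → Fin (a i) → N i

end Modules

/-! ### The category `𝒞 = ⟨N₁, …, Nₙ⟩` and the functor category `𝒞₊₁` -/

section Functors

variable (A : Type w) [CommRing A] (R : Type u) [Ring R] [Algebra A R]
  {ι : Type} (N : ι → Type v) [∀ i, AddCommGroup (N i)] [∀ i, Module R (N i)]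

/-- For an `A`-algebra `R`, the category of `R`-modules is `A`-linear. -/
@[reducible] def moduleCatLinear : Linear A (ModuleCat.{v} R) :=
  letI (X : ModuleCat.{v} R) : Module A X := Module.restrictScalars A R X
  haveI (X : ModuleCat.{v} R) : IsScalarTower A R X := IsScalarTower.restrictScalars A R X
  { homModule := fun _ _ => inferInstance
    smul_comp := by intros; ext; simp
    comp_smul := by intros; ext; simp }

/-- The `R`-modules isomorphic to `⨁ᵢ Nᵢ ^ bᵢ` for some multiplicities `bᵢ`. -/
def isSum : ObjectProperty (ModuleCat.{v} R) := fun X =>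
  ∃ b : ι → ℕ, Nonempty (X ≃ₗ[R] BigModule N b)

/-- The full subcategory `𝒞 = ⟨N₁, …, Nₙ⟩` of the category of `R`-modules. -/
abbrev SumCat := (isSum R N).FullSubcategory

instance sumCatLinear : Linear A (SumCat R N) :=
  letI := moduleCatLinear.{u, v} A R
  Linear.fullSubcategory (isSum R N)

/-- `𝒞₊₁`: the category of `A`-linear functors from `𝒞` to `A`-modules. -/
abbrev FunCat := ObjectProperty.FullSubcategory
  (fun F : SumCat R N ⥤ ModuleCat.{v} A => F.Additive ∧ F.Linear A)

variable {A R N}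

/-- `F ≼ G`: the functor `F` is isomorphic to a subquotient of `G`, i.e. it is a quotient of a
subfunctor `H` of `G`. -/
def IsSubquotient (F G : FunCat A R N) : Prop :=
  ∃ (H : FunCat A R N) (i : H ⟶ G) (p : H ⟶ F),
    (∀ X, Function.Injective (i.hom.app X)) ∧ (∀ X, Function.Surjective (p.hom.app X))

/-- `F ≺ G`. -/
def IsProperSubquotient (F G : FunCat A R N) : Prop :=
  IsSubquotient F G ∧ ¬ Nonempty (F ≅ G)

variable (R N)

/-- `M = ⨁ᵢ Nᵢ ^ aᵢ` as an object of `𝒞`. -/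
def bigObj (a : ι → ℕ) : SumCat R N :=
  ⟨ModuleCat.of R (BigModule N a), a, ⟨LinearEquiv.refl R _⟩⟩

/-- An endomorphism of `M` as a morphism of `𝒞`. -/
def bigHom (a : ι → ℕ) (g : BigModule N a →ₗ[R] BigModule N a) : bigObj R N a ⟶ bigObj R N a :=
  ObjectProperty.homMk (ModuleCat.ofHom g)

lemma bigHom_id (a : ι → ℕ) : bigHom R N a LinearMap.id = 𝟙 _ := rfl

lemma bigHom_comp (a : ι → ℕ) (g h : BigModule N a →ₗ[R] BigModule N a) :
    bigHom R N a (g ∘ₗ h) = bigHom R N a h ≫ bigHom R N a g := rfl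

variable (A)

/-- The functor `F_M = Hom(M, -)`. -/
def homFunctor (a : ι → ℕ) : FunCat A R N :=
  ⟨(linearCoyoneda A (SumCat R N)).obj (Opposite.op (bigObj R N a)),
    inferInstance, ⟨fun f r => ModuleCat.hom_ext (LinearMap.ext fun x => Linear.comp_smul _ _ _ x r f)⟩⟩

/-- Precomposition with an endomorphism `g` of `M`, as an endomorphism of `F_M`. -/
def precomp (a : ι → ℕ) (g : BigModule N a →ₗ[R] BigModule N a) :
    homFunctor A R N a ⟶ homFunctor A R N a :=
  ObjectProperty.homMk ((linearCoyoneda A (SumCat R N)).map (bigHom R N a g).op)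

lemma precomp_id (a : ι → ℕ) : precomp A R N a LinearMap.id = 𝟙 _ :=
  InducedCategory.Hom.ext ((linearCoyoneda A (SumCat R N)).map_id _)

lemma precomp_comp (a : ι → ℕ) (g h : BigModule N a →ₗ[R] BigModule N a) :
    precomp A R N a (g ∘ₗ h) = precomp A R N a g ≫ precomp A R N a h :=
  InducedCategory.Hom.ext
    ((linearCoyoneda A (SumCat R N)).map_comp (bigHom R N a g).op (bigHom R N a h).op)

/-- The Yoneda homomorphism `Aut_R(M) → Aut(F_M)`, sending `g` to precomposition with `g⁻¹`. -/
def yonedaAut (a : ι → ℕ) :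
    (BigModule N a ≃ₗ[R] BigModule N a) →* Aut (homFunctor A R N a) where
  toFun g :=
    { hom := precomp A R N a (g⁻¹ : BigModule N a ≃ₗ[R] BigModule N a)
      inv := precomp A R N a g
      hom_inv_id := by
        rw [← precomp_comp, ← precomp_id]
        congr 1
        exact LinearMap.ext g.symm_apply_apply
      inv_hom_id := by
        rw [← precomp_comp, ← precomp_id]
        congr 1
        exact LinearMap.ext g.apply_symm_apply }
  map_one' := Iso.ext (precomp_id A R N a)
  map_mul' g h := by
    apply Iso.ext
    change precomp A R N a ((g * h)⁻¹ : BigModule N a ≃ₗ[R] BigModule N a) = _ ≫ _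
    rw [mul_inv_rev]
    exact precomp_comp A R N a _ _

/-! ### The permutation representations `KF(M)` and functor morphing -/

variable {A R N}
variable (K : Type*) [Field K]

/-- The vector space `KF(M)` with basis `F(M)`. -/
abbrev PermSpace (a : ι → ℕ) (F : FunCat A R N) := F.obj.obj (bigObj R N a) →₀ K

/-- The map `F(g) : F(M) → F(M)`. -/
def evalMap (a : ι → ℕ) (F : FunCat A R N) (g : BigModule N a →ₗ[R] BigModule N a) :
    F.obj.obj (bigObj R N a) → F.obj.obj (bigObj R N a) :=
  F.obj.map (bigHom R N a g)

lemma evalMap_id (a : ι → ℕ) (F : FunCat A R N) : evalMap a F LinearMap.id = id := by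
  funext x
  exact congr($(F.obj.map_id (bigObj R N a)) x)

lemma evalMap_comp (a : ι → ℕ) (F : FunCat A R N) (g h : BigModule N a →ₗ[R] BigModule N a) :
    evalMap a F (g ∘ₗ h) = evalMap a F g ∘ evalMap a F h := by
  funext x
  exact congr($(F.obj.map_comp (bigHom R N a h) (bigHom R N a g)) x)

/-- The representation of `Aut_R(M)` on `KF(M)` permuting the basis `F(M)`. -/
def permRep (a : ι → ℕ) (F : FunCat A R N) :
    Representation K (BigModule N a ≃ₗ[R] BigModule N a) (PermSpace K a F) where
  toFun g := Finsupp.lmapDomain K K (evalMap a F g)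
  map_one' := by
    change Finsupp.lmapDomain K K (evalMap a F LinearMap.id) = LinearMap.id
    rw [evalMap_id, Finsupp.lmapDomain_id]
  map_mul' g h := by
    change Finsupp.lmapDomain K K (evalMap a F (g ∘ₗ (h : BigModule N a →ₗ[R] BigModule N a))) = _
    rw [evalMap_comp, Finsupp.lmapDomain_comp]
    rfl

/-- The intertwiner `α_* : KF(M) → KG(M)` of a natural transformation `α : F → G`. -/
def pushforward (a : ι → ℕ) {F G : FunCat A R N} (α : F ⟶ G) :
    (permRep K a F).IntertwiningMap (permRep K a G) where
  toLinearMap := Finsupp.lmapDomain K K (α.hom.app (bigObj R N a))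
  isIntertwining' g := by
    change Finsupp.lmapDomain K K _ ∘ₗ Finsupp.lmapDomain K K _ =
      Finsupp.lmapDomain K K _ ∘ₗ Finsupp.lmapDomain K K _
    rw [← Finsupp.lmapDomain_comp, ← Finsupp.lmapDomain_comp]
    congr 1
    funext x
    exact congr($(α.hom.naturality (bigHom R N a (g : BigModule N a →ₗ[R] BigModule N a))) x)

lemma pushforward_id (a : ι → ℕ) (F : FunCat A R N) (x : PermSpace K a F) :
    pushforward K a (𝟙 F) x = x := Finsupp.mapDomain_id

lemma pushforward_comp (a : ι → ℕ) {F G H : FunCat A R N} (α : F ⟶ G) (β : G ⟶ H)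
    (x : PermSpace K a F) :
    pushforward K a (α ≫ β) x = pushforward K a β (pushforward K a α x) :=
  Finsupp.mapDomain_comp (v := x) (f := α.hom.app (bigObj R N a))
    (g := β.hom.app (bigObj R N a))

/-- A subrepresentation `U` of `KF(M)` with `Hom(KG(M), U) = 0` for all `G ≺ F`. -/
def AvoidsSmaller (a : ι → ℕ) {F : FunCat A R N} (U : Subrepresentation (permRep K a F)) : Prop :=
  ∀ G : FunCat A R N, IsProperSubquotient G F →
    ∀ T : (permRep K a G).IntertwiningMap U.toRepresentation, T = 0

lemma AvoidsSmaller.exists_image {a : ι → ℕ} {F : FunCat A R N}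
    {U : Subrepresentation (permRep K a F)} (hU : AvoidsSmaller K a U) (α : Aut F) :
    ∃ U' : Subrepresentation (permRep K a F), AvoidsSmaller K a U' ∧
      ∀ x ∈ U.toSubmodule, pushforward K a α.hom x ∈ U'.toSubmodule := by
  refine ⟨⟨U.toSubmodule.map (pushforward K a α.hom).toLinearMap, ?_⟩, ?_, ?_⟩
  · rintro g _ ⟨x, hx, rfl⟩
    exact ⟨permRep K a F g x, U.apply_mem_toSubmodule g hx,
      congr($((pushforward K a α.hom).isIntertwining' g) x)⟩
  · intro G hG T
    have key : ∀ y, ∃ x ∈ U.toSubmodule, pushforward K a α.hom x = (T y).1 := fun y => (T y).2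
    have hmem : ∀ y, pushforward K a α.inv (T y).1 ∈ U.toSubmodule := by
      intro y
      obtain ⟨x, hx, h⟩ := key y
      rw [← h, ← pushforward_comp, α.hom_inv_id, pushforward_id]
      exact hx
    have h0 := hU G hG
      ⟨LinearMap.codRestrict U.toSubmodule ((pushforward K a α.inv).toLinearMap ∘ₗ
        Submodule.subtype _ ∘ₗ T.toLinearMap) hmem, by
        intro g
        refine LinearMap.ext fun y => Subtype.ext ?_
        change pushforward K a α.inv (T (permRep K a G g y)).1 =
          permRep K a F g (pushforward K a α.inv (T y).1)
        rw [T.isIntertwining, ← (pushforward K a α.inv).isIntertwining]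
        rfl⟩
    apply Representation.IntertwiningMap.ext
    refine LinearMap.ext fun y => Subtype.ext ?_
    have h1 : pushforward K a α.inv (T y).1 = 0 :=
      congrArg Subtype.val (DFunLike.congr_fun h0 y)
    have h2 := congrArg (pushforward K a α.hom) h1
    rw [← pushforward_comp, α.inv_hom_id, pushforward_id, map_zero] at h2
    exact h2
  · intro x hx
    exact ⟨x, hx, rfl⟩

/-- `\overline{KF(M)}`: the largest subrepresentation of `KF(M)` with no non-zero map from any
`KG(M)` with `G ≺ F`, as the sum of all such subrepresentations. -/
def layer (a : ι → ℕ) (F : FunCat A R N) : Subrepresentation (permRep K a F) where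
  toSubmodule := ⨆ U : {U : Subrepresentation (permRep K a F) // AvoidsSmaller K a U},
    U.1.toSubmodule
  apply_mem_toSubmodule g x hx := by
    have : (⨆ U : {U : Subrepresentation (permRep K a F) // AvoidsSmaller K a U},
        U.1.toSubmodule) ≤ (⨆ U : {U : Subrepresentation (permRep K a F) // AvoidsSmaller K a U},
        U.1.toSubmodule).comap (permRep K a F g) :=
      iSup_le fun U y hy => Submodule.mem_iSup_of_mem U (U.1.apply_mem_toSubmodule g hy)
    exact this hx

lemma pushforward_mem_layer (a : ι → ℕ) (F : FunCat A R N) (α : Aut F) (x : PermSpace K a F)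
    (hx : x ∈ (layer K a F).toSubmodule) :
    pushforward K a α.hom x ∈ (layer K a F).toSubmodule := by
  have : (layer K a F).toSubmodule ≤
      (layer K a F).toSubmodule.comap (pushforward K a α.hom).toLinearMap := by
    refine iSup_le fun U y hy => ?_
    obtain ⟨U', hU', h⟩ := U.2.exists_image K α
    exact Submodule.mem_iSup_of_mem ⟨U', hU'⟩ (h y hy)
  exact this hx

/-- The action of `α ∈ Aut(F)` on `\overline{KF(M)}`. -/
def layerMap (a : ι → ℕ) (F : FunCat A R N) (α : Aut F) :
    (layer K a F).toRepresentation.IntertwiningMap (layer K a F).toRepresentation where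
  toLinearMap := (pushforward K a α.hom).toLinearMap.restrict
    (pushforward_mem_layer K a F α)
  isIntertwining' g := by
    ext1 x
    exact Subtype.ext congr($((pushforward K a α.hom).isIntertwining' g) x.1)

variable {V : Type*} [AddCommGroup V] [Module K V] {a : ι → ℕ}

variable {K}

/-- The representation `Hom_{Aut_R(M)}(\overline{KF(M)}, V)` of `Aut(F)`, where `α` acts by
precomposition with `α⁻¹`. For an `F`-typical irreducible `V` this is the dual of the multiplicity
space of `V` in `\overline{KF(M)}`. -/
def morphRep (F : FunCat A R N)
    (ρ : Representation K (BigModule N a ≃ₗ[R] BigModule N a) V) :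
    Representation K (Aut F) ((layer K a F).toRepresentation.IntertwiningMap ρ) where
  toFun α :=
    { toFun := fun T => T.comp (layerMap K a F α⁻¹)
      map_add' := fun _ _ => rfl
      map_smul' := fun _ _ => rfl }
  map_one' := by
    ext T x
    change T (layerMap K a F 1⁻¹ x) = T x
    congr 1
    rw [inv_one]
    exact Subtype.ext (pushforward_id K a F x.1)
  map_mul' α β := by
    ext T x
    change T (layerMap K a F (α * β)⁻¹ x) = T (layerMap K a F β⁻¹ (layerMap K a F α⁻¹ x))
    congr 1
    rw [mul_inv_rev]
    exact Subtype.ext (pushforward_comp K a (α⁻¹).hom (β⁻¹).hom x.1)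

/-- `V` is `F`-typical: `V` occurs in `KF(M)` but in no `KG(M)` with `G ≺ F`. -/
def IsTypical (F : FunCat A R N)
    (ρ : Representation K (BigModule N a ≃ₗ[R] BigModule N a) V) : Prop :=
  (∃ T : (permRep K a F).IntertwiningMap ρ, T ≠ 0) ∧
    ∀ G : FunCat A R N, IsProperSubquotient G F → ∀ T : (permRep K a G).IntertwiningMap ρ, T = 0

/-- The functor morphing relation `(M, V) ⇝ (F, Ṽ)`. -/
def Morphs (ρ : Representation K (BigModule N a ≃ₗ[R] BigModule N a) V)
    (F : FunCat A R N) {V' : Type*} [AddCommGroup V'] [Module K V']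
    (τ : Representation K (Aut F) V') : Prop :=
  IsTypical F ρ ∧ Nonempty (τ.Equiv (morphRep F ρ))

variable (A)

/-- `V` admits trivial functor morphing: `(M, V) ⇝ (Hom(M, -), V)`, where `Aut(Hom(M, -))` acts on
`V` through the Yoneda isomorphism with `Aut_R(M)`. -/
def HasTrivialMorphing (ρ : Representation K (BigModule N a ≃ₗ[R] BigModule N a) V) : Prop :=
  ∃ τ : Representation K (Aut (homFunctor A R N a)) V,
    (∀ g, τ (yonedaAut A R N a g) = ρ g) ∧ Morphs ρ (homFunctor A R N a) τ

end Functors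

/-! ### The left maximal graph -/

section Graph

variable {R : Type u} [Ring R] {ι : Type} (N : ι → Type v)
  [∀ i, AddCommGroup (N i)] [∀ i, Module R (N i)]

/-- `f : N_j → N_i` is left maximal: it is non-zero, not invertible, and is killed by every
non-invertible morphism out of `N_i` to some `N_k`. -/
def IsLeftMaximal {j i : ι} (f : N j →ₗ[R] N i) : Prop :=
  f ≠ 0 ∧ ¬ Function.Bijective f ∧
    ∀ (k : ι) (g : N i →ₗ[R] N k), ¬ Function.Bijective g → g ∘ₗ f = 0

variable (R)

/-- The residue ring `E_i` of `End(N_i)` modulo its Jacobson radical. -/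
abbrev Residue (i : ι) : Type v :=
  Module.End R (N i) ⧸ Ring.jacobson (Module.End R (N i))

/-- `LM(N_j, N_i)`. For pairwise non-isomorphic finite indecomposable modules, the left maximal
morphisms together with `0` already form an `End(N_i)`-submodule under postcomposition, and the
span below adds nothing. -/
def LM (j i : ι) : Submodule (Module.End R (N i)) (N j →ₗ[R] N i) :=
  Submodule.span _ {f | IsLeftMaximal N f}

lemma not_bijective_of_mem_jacobson {i : ι} [Nontrivial (N i)] {u : Module.End R (N i)}
    (hu : u ∈ Ring.jacobson (Module.End R (N i))) : ¬ Function.Bijective u := by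
  intro hb
  have hunit : IsUnit u := (Module.End.isUnit_iff u).2 hb
  have := Ideal.eq_top_of_isUnit_mem _ hu hunit
  exact (Ring.jacobson_lt_top (Module.End R (N i))).ne this

lemma isTorsion_LM (j i : ι) : Module.IsTorsionBySet (Module.End R (N i)) (LM R N j i)
    (Ring.jacobson (Module.End R (N i)) : Ideal (Module.End R (N i))) := by
  rintro ⟨f, hf⟩ ⟨u, hu⟩
  apply Subtype.ext
  change u • f = 0
  rcases subsingleton_or_nontrivial (N i) with hs | hs
  · ext x; exact Subsingleton.elim _ _
  · revert u
    induction hf using Submodule.span_induction with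
    | mem f hf =>
      intro u hu
      exact hf.2.2 i u (not_bijective_of_mem_jacobson R N hu)
    | zero => intro u _; simp
    | add f g _ _ h1 h2 => intro u hu; rw [smul_add, h1 u hu, h2 u hu, add_zero]
    | smul e f _ h =>
      intro u hu
      rw [smul_smul]
      exact h _ (Ideal.mul_mem_right e _ hu)

/-- The `E_i`-vector space structure on `LM(N_j, N_i)`, by postcomposition. -/
instance moduleLM (j i : ι) : Module (Residue R N i) (LM R N j i) :=
  (isTorsion_LM R N j i).module

/-- The number `dim_{E_i} LM(N_j, N_i)` of arrows from `j` to `i` in the directed multigraph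
`LM(N₁, …, Nₙ)`, whose vertices are the indices. -/
def numArrows (j i : ι) : ℕ := Module.finrank (Residue R N i) (LM R N j i)

/-- The left maximal graph is a disjoint union of single vertices, each with exactly one
self-loop. -/
def IsUnionOfLoops : Prop :=
  (∀ i, numArrows R N i i = 1) ∧ ∀ j i, j ≠ i → numArrows R N j i = 0

end Graph

/-! ### The auxiliary ring `R̃ = R ⊕ R ⊗ R` and its modules -/

section Auxiliary

open scoped TensorProduct

variable (R : Type u) [Ring R]

/-- The free `R`-bimodule `R ⊗_ℤ R = RxR` on one generator `x = 1 ⊗ 1`. -/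
def FreeBimodule : Type u := R ⊗[ℤ] R

namespace FreeBimodule

instance : AddCommGroup (FreeBimodule R) := inferInstanceAs (AddCommGroup (R ⊗[ℤ] R))

/-- Left action: `r (b₁ x b₂) = (r b₁) x b₂`. -/
instance : Module R (FreeBimodule R) := inferInstanceAs (Module R (R ⊗[ℤ] R))

/-- Right multiplication by `r` on the second factor: `(b₁ x b₂) r = b₁ x (b₂ r)`. -/
def rightMul : Rᵐᵒᵖ →+* AddMonoid.End (FreeBimodule R) where
  toFun r := (LinearMap.lTensor R (LinearMap.mulRight ℤ r.unop)).toAddMonoidHom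
  map_one' := by
    ext z
    change LinearMap.lTensor R (LinearMap.mulRight ℤ (1 : R)) z = z
    simp
  map_mul' r s := by
    ext z
    change LinearMap.lTensor R (LinearMap.mulRight ℤ (s.unop * r.unop)) z =
      LinearMap.lTensor R (LinearMap.mulRight ℤ r.unop)
        (LinearMap.lTensor R (LinearMap.mulRight ℤ s.unop) z)
    rw [LinearMap.mulRight_mul, LinearMap.lTensor_comp]
    rfl
  map_zero' := by
    ext z
    change LinearMap.lTensor R (LinearMap.mulRight ℤ (0 : R)) z = 0
    simp
  map_add' r s := by
    ext z
    change LinearMap.lTensor R (LinearMap.mulRight ℤ (r.unop + s.unop)) z =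
      LinearMap.lTensor R (LinearMap.mulRight ℤ r.unop) z +
        LinearMap.lTensor R (LinearMap.mulRight ℤ s.unop) z
    have : LinearMap.mulRight ℤ (r.unop + s.unop) =
      LinearMap.mulRight ℤ r.unop + LinearMap.mulRight ℤ s.unop := by
      ext; simp [mul_add]
    rw [this, LinearMap.lTensor_add]
    rfl

instance : Module Rᵐᵒᵖ (FreeBimodule R) := Module.compHom _ (rightMul R)

variable {R}

/-- The element `b₁ x b₂`. -/
def mk (b₁ b₂ : R) : FreeBimodule R := b₁ ⊗ₜ[ℤ] b₂

lemma smul_mk (r b₁ b₂ : R) : r • mk b₁ b₂ = mk (r * b₁) b₂ :=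
  TensorProduct.smul_tmul' r b₁ b₂

lemma op_smul_mk (r b₁ b₂ : R) : MulOpposite.op r • mk b₁ b₂ = mk b₁ (b₂ * r) :=
  rfl

@[elab_as_elim]
lemma induction {p : FreeBimodule R → Prop} (z : FreeBimodule R) (h0 : p 0)
    (hm : ∀ b₁ b₂, p (mk b₁ b₂)) (ha : ∀ y z, p y → p z → p (y + z)) : p z :=
  TensorProduct.induction_on (motive := p) z h0 hm ha

instance : SMulCommClass R Rᵐᵒᵖ (FreeBimodule R) where
  smul_comm r s z := by
    induction z using FreeBimodule.induction with
    | h0 => simp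
    | hm b₁ b₂ =>
      obtain ⟨s, rfl⟩ := MulOpposite.op_surjective s
      rw [op_smul_mk, smul_mk, smul_mk, op_smul_mk]
    | ha y z hy hz => simp only [smul_add, hy, hz]

end FreeBimodule

/-- The ring `R̃ = R ⊕ R ⊗_ℤ R = R ⊕ RxR`, with product
`(a + b₁xb₂)(c + d₁xd₂) = ac + ad₁xd₂ + b₁xb₂c`. -/
abbrev RTilde : Type u := TrivSqZeroExt R (FreeBimodule R)

variable {R} {X : Type v} [AddCommGroup X] [Module R X]

/-- An `R`-linear endomorphism as an additive one. -/
def endOf (t : X →ₗ[R] X) : AddMonoid.End X := t.toAddMonoidHom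

/-- The additive map by which `∑ b₁ x b₂` acts when `x` acts as `t`: `m ↦ ∑ b₁ t(b₂ m)`. -/
def bimoduleAct (t : X →ₗ[R] X) : FreeBimodule R →+ AddMonoid.End X :=
  TensorProduct.liftAddHom
    { toFun := fun b₁ =>
        { toFun := fun b₂ => Module.toAddMonoidEnd R X b₁ * endOf t *
            Module.toAddMonoidEnd R X b₂
          map_zero' := by simp
          map_add' := fun _ _ => by rw [map_add, mul_add] }
      map_zero' := by ext; simp
      map_add' := fun _ _ => by ext1; simp only [map_add, add_mul]; rfl }
    (fun r b₁ b₂ => by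
      change Module.toAddMonoidEnd R X (r • b₁) * _ * _ = _ * _ * Module.toAddMonoidEnd R X (r • b₂)
      rw [map_zsmul, map_zsmul, smul_mul_assoc, smul_mul_assoc, mul_smul_comm])

lemma bimoduleAct_mk (t : X →ₗ[R] X) (b₁ b₂ : R) (m : X) :
    bimoduleAct t (FreeBimodule.mk b₁ b₂) m = b₁ • t (b₂ • m) := rfl

/-- The ring homomorphism `R̃ → End(X)` extending the action of `R` by letting `x` act as `t`. -/
def tildeHom (t : X →ₗ[R] X) (ht : t ∘ₗ t = 0) : RTilde R →+* AddMonoid.End X where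
  toFun z := Module.toAddMonoidEnd R X z.fst + bimoduleAct t z.snd
  map_one' := by simp
  map_zero' := by simp
  map_add' y z := by
    simp only [TrivSqZeroExt.fst_add, TrivSqZeroExt.snd_add, map_add]
    abel
  map_mul' y z := by
    have h1 : ∀ (r : R) (w : FreeBimodule R),
        bimoduleAct t (r • w) = Module.toAddMonoidEnd R X r * bimoduleAct t w := by
      intro r w
      induction w using FreeBimodule.induction with
      | h0 => simp
      | hm b₁ b₂ =>
        ext m
        rw [FreeBimodule.smul_mk, bimoduleAct_mk, mul_smul]
        rfl
      | ha y z hy hz => rw [smul_add, map_add, hy, hz, map_add, mul_add]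
    have h2 : ∀ (r : R) (w : FreeBimodule R),
        bimoduleAct t (MulOpposite.op r • w) = bimoduleAct t w * Module.toAddMonoidEnd R X r := by
      intro r w
      induction w using FreeBimodule.induction with
      | h0 => simp
      | hm b₁ b₂ =>
        ext m
        rw [FreeBimodule.op_smul_mk, bimoduleAct_mk, mul_smul]
        rfl
      | ha y z hy hz => rw [smul_add, map_add, hy, hz, map_add, add_mul]
    have h3 : ∀ w w' : FreeBimodule R, bimoduleAct t w * bimoduleAct t w' = 0 := by
      intro w w'
      induction w using FreeBimodule.induction with
      | h0 => simp
      | hm b₁ b₂ =>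
        induction w' using FreeBimodule.induction with
        | h0 => simp
        | hm c₁ c₂ =>
          ext m
          change b₁ • t (b₂ • c₁ • t (c₂ • m)) = 0
          have : t (t (c₂ • m)) = 0 := congr($ht (c₂ • m))
          rw [map_smul, map_smul, this]
          simp
        | ha y z hy hz => rw [map_add, mul_add, hy, hz, add_zero]
      | ha y z hy hz => rw [map_add, add_mul, hy, hz, add_zero]
    simp only [TrivSqZeroExt.fst_mul, TrivSqZeroExt.snd_mul, map_add, map_mul, h1, h2, add_mul,
      mul_add, h3, add_zero]
    abel

/-- The `R̃`-module with underlying `R`-module `X` on which `x` acts as the square-zero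
endomorphism `t`. -/
def TildeModule (t : X →ₗ[R] X) (_ : t ∘ₗ t = 0) : Type v := X

instance (t : X →ₗ[R] X) (ht : t ∘ₗ t = 0) : AddCommGroup (TildeModule t ht) :=
  inferInstanceAs (AddCommGroup X)

instance (t : X →ₗ[R] X) (ht : t ∘ₗ t = 0) : Module (RTilde R) (TildeModule t ht) :=
  Module.compHom X (tildeHom t ht)

end Auxiliary

/-! ### Cycles of the left maximal graph and the module `M̃` -/

section Cycle

variable (R : Type u) [Ring R] {ι : Type} [DecidableEq ι] (N : ι → Type v)
  [∀ i, AddCommGroup (N i)] [∀ i, Module R (N i)] (a : ι → ℕ)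

/-- A directed cycle `v₀ → v₁ → ⋯ → v_k → v₀` of `k + 1 > 1` distinct vertices of the left maximal
graph, consecutive vertices being joined by exactly one arrow, with all multiplicities equal along
the cycle, together with a basis element `f_p` of the line `LM(N_{v_p}, N_{v_{p+1}})` for `p < k`. -/
structure LongCycle where
  k : ℕ
  one_le_k : 1 ≤ k
  v : Fin (k + 1) → ι
  v_injective : Function.Injective v
  -- addition in `Fin (k + 1)` is cyclic, so `p = k` gives the closing arrow
  numArrows_eq_one : ∀ p : Fin (k + 1), numArrows R N (v p) (v (p + 1)) = 1
  f : ∀ p : Fin k, N (v p.castSucc) →ₗ[R] N (v p.succ)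
  isLeftMaximal : ∀ p, IsLeftMaximal N (f p)
  mult_eq : ∀ p : Fin k, a (v p.castSucc) = a (v p.succ)

variable {R N a}

/-- The map `(m₁, …, m_a) ↦ (f m₁, …, f m_a)` from the summand `N_j ^ a` of `M` to `N_i ^ a`, zero
on the other summands. -/
def blockMap {j i : ι} (h : a j = a i) (f : N j →ₗ[R] N i) : BigModule N a →ₗ[R] BigModule N a :=
  LinearMap.single R (fun i => Fin (a i) → N i) i ∘ₗ LinearMap.funLeft R (N i) (Fin.cast h.symm) ∘ₗ
    f.compLeft (Fin (a j)) ∘ₗ LinearMap.proj j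

lemma blockMap_comp_blockMap {j i j' i' : ι} (h : a j = a i) (h' : a j' = a i')
    (f : N j →ₗ[R] N i) (hf : IsLeftMaximal N f) (g : N j' →ₗ[R] N i') (hg : IsLeftMaximal N g) :
    blockMap h' g ∘ₗ blockMap h f = 0 := by
  refine LinearMap.ext fun m => ?_
  change Pi.single (M := fun i => Fin (a i) → N i) i' (fun s => g ((Pi.single i (fun s => f (m j (Fin.cast h.symm s))) :
    BigModule N a) j' (Fin.cast h'.symm s))) = 0
  rw [Pi.single_eq_zero_iff]
  funext s
  by_cases hij : i = j'
  · subst hij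
    rw [Pi.single_eq_same]
    exact congr($(hf.2.2 i' g hg.2.1) _)
  · rw [Pi.single_eq_of_ne (Ne.symm hij)]
    exact map_zero g

/-- The action of `x` on `M`: it is `f_p` on each copy of `N_{v_p}`, into the corresponding copy of
`N_{v_{p+1}}`, for `p < k`, and zero on all other summands. -/
def LongCycle.shift (c : LongCycle R N a) : BigModule N a →ₗ[R] BigModule N a :=
  ∑ p : Fin c.k, blockMap (c.mult_eq p) (c.f p)

lemma LongCycle.shift_comp_shift (c : LongCycle R N a) : c.shift ∘ₗ c.shift = 0 := by
  change c.shift * c.shift = 0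
  rw [LongCycle.shift, Finset.sum_mul_sum]
  exact Finset.sum_eq_zero fun p _ => Finset.sum_eq_zero fun q _ =>
    blockMap_comp_blockMap _ _ _ (c.isLeftMaximal _) _ (c.isLeftMaximal _)

/-- The `R̃`-module `M̃` attached to a cycle. -/
abbrev LongCycle.MTilde (c : LongCycle R N a) : Type v := TildeModule c.shift c.shift_comp_shift

end Cycle

/-! ### The two reductions -/

section Reductions

/-- `X` has a splitting `X = P ⊕ Q` into non-zero submodules with `Aut(X) = Aut(P) × Aut(Q)`:
every automorphism of `X` is the direct sum of one of `P` and one of `Q`. -/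
def AutSplits (R : Type u) [Ring R] (X : Type v) [AddCommGroup X] [Module R X] : Prop :=
  ∃ P Q : Submodule R X, IsCompl P Q ∧ P ≠ ⊥ ∧ Q ≠ ⊥ ∧
    ∀ g : X ≃ₗ[R] X, ∃ (g₁ : P ≃ₗ[R] P) (g₂ : Q ≃ₗ[R] Q),
      (∀ x : P, g x = g₁ x) ∧ ∀ x : Q, g x = g₂ x

/-- The representation `ρ` of `G` is induced from some representation of the subgroup `H`. -/
def IsInducedFrom {G K : Type*} {V : Type v} [Group G] [Field K] [AddCommGroup V] [Module K V]
    (ρ : Representation K G V) (H : Subgroup G) : Prop :=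
  ∃ (W : Type v) (_ : AddCommGroup W) (_ : Module K W) (σ : Representation K H W),
    Nonempty (ρ.Equiv (Representation.ind H.subtype σ))

end Reductions

end

end FunctorMorphing

namespace FunctorMorphing

noncomputable section

/-! ### Characters of finite abelian groups -/

section Characters

/-! Write E = End(M). The lever is `AvoidsProperQuotients`: V occurs in no KG(M) with G ≺ Hom(M, -).
Every non-zero left ideal L of E gives such a G, a proper quotient of Hom(M, -) with value E/L at M.
Hence an equivariant function E → V that is invariant under translation by L vanishes
(`eq_zero_of_translation_invariant`). Applied to e ↦ ρ(e)v on units, extended by zero, this has two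
consequences. If 1 + L consists of units, then 1 + L fixes no non-zero vector
(`eq_zero_of_fixed_by_one_add_ideal`). By Fourier inversion, some additive character of E is
non-trivial on every non-zero left ideal (`subsingleton_of_forall_addChar`).

The character determines the graph. Pairing it with the morphisms M → Nᵢ killed by all non-bijective
morphisms out of Nᵢ shows that these have dimension at most aᵢ over Eᵢ (`card_socle_le`). So the
in-degree of i, with sources weighted by multiplicity, is at most aᵢ. If no non-zero non-bijective
morphism leaves some Nᵢ, the same bound forbids morphisms into Nᵢ from other summands, and either
Aut(M) splits or n = 1 and End(N₁) is a field. Otherwise every vertex has an outgoing arrow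
(`exists_numArrows_ne_zero`), and double counting forces the graph to be that of a permutation
preserving multiplicities (`exists_perm_of_sum_le`). The identity permutation is the case of loops.

A non-trivial cycle, with its closing arrow omitted, gives a square-zero shift x. Since each vertex
receives a single arrow, I = Ex is a two-sided ideal with I² = 0, and 1 + I is an abelian normal
subgroup. A character of I occurring in V is trivial on no non-zero left ideal inside I, by the
first consequence. All such characters are conjugate to a trace character
(`IsTraceCharacter.exists_conj`), whose stabilizer is the centralizer of x
(`IsTraceCharacter.stabilizer`), that is, the automorphism group of M over R̃. Clifford theory then
gives the induction (`LongCycle.isInducedFrom_autCentralizer`). -/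

lemma neZero_exponent {K : Type*} [Field K] [CharZero K] (G : Type*) [Group G] [Finite G] :
    NeZero ((Monoid.exponent G : ℕ) : K) :=
  ⟨Nat.cast_ne_zero.2 Monoid.exponent_ne_zero_of_finite⟩

variable {K : Type*} [Field K] [IsAlgClosed K] [CharZero K] {A : Type*} [AddCommGroup A] [Finite A]

/-- Additive characters with values in a field, as homomorphisms to its group of units. -/
def addCharEquivUnits (A K : Type*) [AddCommGroup A] [Field K] :
    AddChar A K ≃ (Multiplicative A →* Kˣ) where
  toFun ψ := ψ.toMonoidHom.toHomUnits
  invFun φ := AddChar.toMonoidHomEquiv.symm ((Units.coeHom K).comp φ)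
  left_inv _ := rfl
  right_inv _ := by ext; rfl

variable (K) in
lemma natCard_addChar : Nat.card (AddChar A K) = Nat.card A := by
  have := neZero_exponent (K := K) (Multiplicative A)
  rw [Nat.card_congr (addCharEquivUnits A K),
    CommGroup.card_monoidHom_of_hasEnoughRootsOfUnity]
  rfl

instance finite_addChar : Finite (AddChar A K) :=
  Nat.finite_of_card_ne_zero (by rw [natCard_addChar]; exact Nat.card_pos.ne')

variable (K) in
lemma exists_addChar_ne_one {x : A} (hx : x ≠ 0) : ∃ ψ : AddChar A K, ψ x ≠ 1 := by
  have := neZero_exponent (K := K) (Multiplicative A)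
  obtain ⟨φ, hφ⟩ := CommGroup.exists_apply_ne_one_of_hasEnoughRootsOfUnity (Multiplicative A) K
    (a := Multiplicative.ofAdd x) (fun h => hx (Multiplicative.ofAdd.injective h))
  exact ⟨(addCharEquivUnits A K).symm φ, fun h => hφ (Units.ext h)⟩

/-- Separation by a subgroup of characters forces it to contain all characters. -/
lemma eq_top_of_separates (B : Subgroup (AddChar A K)) (hB : ∀ u, (∀ b ∈ B, b u = 1) → u = 0) :
    B = ⊤ := by
  have := neZero_exponent (K := K) B
  -- Separation embeds A into the dual of B, so |A| ≤ |B|; as the full dual of A has only |A|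
  -- elements, B is everything.
  let ev : A → (B →* Kˣ) := fun u => MonoidHom.toHomUnits
    { toFun := fun b => b.1 u, map_one' := rfl, map_mul' := fun _ _ => rfl }
  have hinj : Function.Injective ev := by
    intro u w h
    rw [← sub_eq_zero]
    refine hB _ fun b hb => ?_
    have hval : b u = b w := congrArg Units.val (DFunLike.congr_fun h (⟨b, hb⟩ : B))
    have := b.val_isUnit w
    rw [AddChar.map_sub_eq_div, hval, div_self this.ne_zero]
  have hcard := CommGroup.card_monoidHom_of_hasEnoughRootsOfUnity B K
  have hfin : Finite (B →* Kˣ) := Nat.finite_of_card_ne_zero (by rw [hcard]; exact Nat.card_pos.ne')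
  have h1 := Nat.card_le_card_of_injective ev hinj
  rw [hcard, ← natCard_addChar K] at h1
  exact B.eq_top_of_le_card h1

/-- Pigeonhole: the dual of A has |A| elements, so a larger X cannot embed in it. In `card_socle_le`
this yields a morphism generating a left ideal on which a given character is trivial. -/
lemma exists_forall_eq_one_of_card_lt {X : Type*} [AddCommGroup X] [Finite X]
    (β : X →+ AddChar A K) (h : Nat.card A < Nat.card X) :
    ∃ x ≠ 0, ∀ y, β x y = 1 := by
  by_contra! hcon
  have hinj : Function.Injective β := by
    rw [injective_iff_map_eq_zero]
    intro x hx
    by_contra hne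
    obtain ⟨y, hy⟩ := hcon x hne
    exact hy (by rw [hx]; rfl)
  have := Nat.card_le_card_of_injective β hinj
  rw [natCard_addChar] at this
  omega

variable {V : Type*} [AddCommGroup V] [Module K V]

lemma sum_addChar_apply_eq_zero [Fintype (AddChar A K)] {x : A} (hx : x ≠ 0) :
    ∑ ψ : AddChar A K, ψ x = 0 := by
  obtain ⟨φ, hφ⟩ := exists_addChar_ne_one K hx
  have h : φ x * ∑ ψ : AddChar A K, ψ x = ∑ ψ : AddChar A K, ψ x := by
    rw [Finset.mul_sum]
    exact Fintype.sum_equiv (Equiv.mulLeft φ) _ _ fun ψ => rfl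
  exact (mul_left_eq_self₀.1 h).resolve_left hφ

/-- Fourier inversion. -/
lemma sum_addChar_smul_sum [Fintype A] [Fintype (AddChar A K)] (t : A → V) (w : A) :
    ∑ ψ : AddChar A K, ∑ u : A, ψ (u - w) • t u = (Nat.card A : K) • t w := by
  rw [Finset.sum_comm]
  simp_rw [← Finset.sum_smul]
  rw [Finset.sum_eq_single w]
  · rw [sub_self]
    simp only [AddChar.map_zero_eq_one, Finset.sum_const, Finset.card_univ, nsmul_eq_mul, mul_one]
    rw [← Nat.card_eq_fintype_card, natCard_addChar]
  · intro u _ hu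
    rw [sum_addChar_apply_eq_zero (sub_ne_zero.2 hu), zero_smul]
  · simp

lemma eq_zero_of_fourier_eq_zero [Fintype A] (t : A → V)
    (h : ∀ ψ : AddChar A K, ∑ u : A, ψ u • t u = 0) : t = 0 := by
  have := Fintype.ofFinite (AddChar A K)
  funext w
  have h1 := sum_addChar_smul_sum (K := K) t w
  have h2 : ∀ ψ : AddChar A K, ∑ u : A, ψ (u - w) • t u = 0 := fun ψ => by
    have : ∀ u, ψ (u - w) • t u = ψ (-w) • ψ u • t u := fun u => by
      rw [smul_smul, ← AddChar.map_add_eq_mul, neg_add_eq_sub]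
    simp_rw [this, ← Finset.smul_sum, h, smul_zero]
  simp_rw [h2, Finset.sum_const_zero] at h1
  exact (smul_eq_zero.1 h1.symm).resolve_left (Nat.cast_ne_zero.2 Nat.card_pos.ne')

end Characters

/-! ### Quotients of `Hom(M, -)` by left ideals of `End(M)` -/

section QuotientFunctor

variable (A : Type w) [CommRing A] {R : Type u} [Ring R] [Algebra A R]
  {ι : Type} {N : ι → Type v} [∀ i, AddCommGroup (N i)] [∀ i, Module R (N i)] {a : ι → ℕ}
  (L : Ideal (Module.End R (BigModule N a)))

/-- The value at `X` of the subfunctor of `Hom(M, -)` whose value at `M` is the left ideal `L`. -/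
def idealSub (X : SumCat R N) : Submodule A (bigObj R N a ⟶ X) where
  carrier := {h | ∀ r : X ⟶ bigObj R N a, ((h ≫ r).hom.hom : Module.End R (BigModule N a)) ∈ L}
  zero_mem' r := by
    rw [Limits.zero_comp]
    exact L.zero_mem
  add_mem' {h h'} hh hh' r := by
    rw [Preadditive.add_comp]
    exact L.add_mem (hh r) (hh' r)
  smul_mem' c h hh r := by
    rw [Linear.smul_comp, ← Linear.comp_smul]
    exact hh (c • r)

lemma mem_idealSub_bigHom (e : Module.End R (BigModule N a)) :
    (bigHom R N a e ∈ idealSub A L (bigObj R N a)) ↔ e ∈ L := by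
  refine ⟨fun h => h (𝟙 _), fun h r => ?_⟩
  exact L.mul_mem_left (r.hom.hom : Module.End R (BigModule N a)) h

/-- The quotient of the functor `Hom(M, -)` by the subfunctor generated by a left ideal of
`End(M)`. -/
def quotientFunctor : FunCat A R N where
  obj :=
    { obj := fun X => ModuleCat.of A ((bigObj R N a ⟶ X) ⧸ idealSub A L X)
      map := fun {X Y} f => ModuleCat.ofHom
        (Submodule.mapQ _ _ (Linear.rightComp A (bigObj R N a) f) (fun h hh r => by
          change ((h ≫ f) ≫ r).hom.hom ∈ L
          rw [Category.assoc]
          exact hh _))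
      map_id := fun X => by
        ext h
        change Submodule.Quotient.mk (h ≫ 𝟙 X) = Submodule.Quotient.mk h
        rw [Category.comp_id]
      map_comp := fun f g => by
        ext h
        change Submodule.Quotient.mk (h ≫ f ≫ g) = Submodule.Quotient.mk ((h ≫ f) ≫ g)
        rw [Category.assoc] }
  property := by
    refine ⟨⟨fun {X Y f g} => ?_⟩, ⟨fun {X Y} f c => ?_⟩⟩
    · ext h
      exact congrArg (idealSub A L Y).mkQ (Preadditive.comp_add _ _ _ h f g)
    · ext h
      exact congrArg (idealSub A L Y).mkQ (Linear.comp_smul _ _ _ h c f)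

/-- The projection from `Hom(M, -)` to its quotient by a left ideal. -/
def toQuotientFunctor : homFunctor A R N a ⟶ quotientFunctor A L :=
  ObjectProperty.homMk
    { app := fun X => ModuleCat.ofHom (idealSub A L X).mkQ
      naturality := fun _ _ _ => rfl }

/-- Properness is a count at the object M: an isomorphism would make the surjection E → E/L ≅ E of
finite sets injective, forcing L = 0. -/
lemma isProperSubquotient_quotientFunctor [Finite ι] [∀ i, Finite (N i)] (hL : L ≠ ⊥) :
    IsProperSubquotient (quotientFunctor A L) (homFunctor A R N a) := by
  refine ⟨⟨homFunctor A R N a, 𝟙 _, toQuotientFunctor A L, fun X => Function.injective_id,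
    fun X => (idealSub A L X).mkQ_surjective⟩, ?_⟩
  rintro ⟨α⟩
  have hfin : Finite (bigObj R N a ⟶ bigObj R N a) :=
    Finite.of_injective (β := BigModule N a → BigModule N a)
      (fun h => (h.hom.hom : Module.End R (BigModule N a))) fun h h' hh => by
        ext1; ext1; exact DFunLike.coe_injective hh
  let β : ((bigObj R N a ⟶ bigObj R N a) ⧸ idealSub A L (bigObj R N a)) →
      (bigObj R N a ⟶ bigObj R N a) := α.hom.hom.app (bigObj R N a)
  have hβ : Function.Surjective β := by
    intro y
    refine ⟨α.inv.hom.app (bigObj R N a) y, ?_⟩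
    exact congr($(congr(($(α.inv_hom_id)).hom.app (bigObj R N a))) y)
  have hmk : Function.Injective (β ∘ Submodule.Quotient.mk) :=
    Finite.injective_iff_surjective.2 (hβ.comp (Submodule.Quotient.mk_surjective _))
  obtain ⟨l, hl, hne⟩ := Submodule.exists_mem_ne_zero_of_ne_bot hL
  apply hne
  have h0 : bigHom R N a l = bigHom R N a 0 := by
    apply hmk.of_comp
    rw [Submodule.Quotient.eq]
    exact (mem_idealSub_bigHom A L (l - 0)).2 (by rwa [sub_zero])
  exact congr(($h0).hom.hom)

variable {A L} {K : Type*} [Field K] {V : Type*} [AddCommGroup V] [Module K V]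
  {ρ : Representation K (BigModule N a ≃ₗ[R] BigModule N a) V}

/-- An equivariant function on `End(M)` that is invariant under translations by a non-zero left
ideal vanishes if `ρ` does not occur in smaller functors. -/
lemma eq_zero_of_translation_invariant [Finite ι] [∀ i, Finite (N i)]
    (hρ : ∀ G : FunCat A R N, IsProperSubquotient G (homFunctor A R N a) →
      ∀ T : (permRep K a G).IntertwiningMap ρ, T = 0)
    (hL : L ≠ ⊥) (t : Module.End R (BigModule N a) → V)
    (ht : ∀ (g : BigModule N a ≃ₗ[R] BigModule N a) e,
      t ((g : BigModule N a →ₗ[R] BigModule N a) ∘ₗ e) = ρ g (t e))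
    (hinv : ∀ e, ∀ l ∈ L, t (e + l) = t e) : t = 0 := by
  -- Translation invariance lets t descend to the basis G(M) of KG(M); its linear extension is an
  -- intertwiner KG(M) → V, hence zero by hypothesis.
  let t' : (quotientFunctor A L).obj.obj (bigObj R N a) → V :=
    Quotient.lift (s := (idealSub A L (bigObj R N a)).quotientRel) (fun h => t h.hom.hom)
      (fun h h' hh => by
      have h1 : h - h' ∈ idealSub A L (bigObj R N a) :=
        (Submodule.quotientRel_def _).1 hh
      have h2 : (h.hom.hom - h'.hom.hom : Module.End R (BigModule N a)) ∈ L := h1 (𝟙 _)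
      have h3 := hinv h'.hom.hom _ h2
      exact (congrArg t (add_sub_cancel (G := Module.End R (BigModule N a)) _ _)).symm.trans h3)
  have h0 := hρ (quotientFunctor A L) (isProperSubquotient_quotientFunctor A L hL)
    ⟨Finsupp.linearCombination K t', fun g => by
      refine Finsupp.lhom_ext' fun q => LinearMap.ext_ring ?_
      obtain ⟨h, rfl⟩ := Submodule.Quotient.mk_surjective _ q
      change Finsupp.linearCombination K t' (Finsupp.mapDomain
          (evalMap a (quotientFunctor A L) (g : BigModule N a →ₗ[R] BigModule N a))
            (Finsupp.single ((idealSub A L (bigObj R N a)).mkQ h) 1)) =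
        ρ g (Finsupp.linearCombination K t'
          (Finsupp.single ((idealSub A L (bigObj R N a)).mkQ h) 1))
      erw [Finsupp.mapDomain_single, Finsupp.linearCombination_single,
        Finsupp.linearCombination_single, one_smul, one_smul]
      exact ht g h.hom.hom⟩
  funext e
  let q : (quotientFunctor A L).obj.obj (bigObj R N a) :=
    (idealSub A L (bigObj R N a)).mkQ (bigHom R N a e)
  have h1 : Finsupp.linearCombination K t' (Finsupp.single q 1) = 0 :=
    DFunLike.congr_fun h0 (Finsupp.single q 1)
  rw [Finsupp.linearCombination_single, one_smul] at h1
  exact h1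

end QuotientFunctor

/-! ### Morphisms between finite indecomposable modules -/

section Indecomposable

variable {R : Type u} [Ring R] {X Y Z : Type v} [AddCommGroup X] [Module R X] [AddCommGroup Y]
  [Module R Y] [AddCommGroup Z] [Module R Z]

/-- Fitting's lemma. -/
lemma IsIndecomposable.bijective_or_isNilpotent [Finite X] (hX : IsIndecomposable R X)
    (f : Module.End R X) : Function.Bijective f ∨ IsNilpotent f := by
  obtain ⟨n, hn⟩ := Filter.eventually_atTop.1 f.eventually_isCompl_ker_pow_range_pow
  have hc := hn (n + 1) n.le_succ
  rcases hX.2 _ _ hc with h | h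
  · left
    have hinj : Function.Injective (f ^ n * f : Module.End R X) := by
      rw [← pow_succ]; exact LinearMap.ker_eq_bot.1 h
    exact Finite.injective_iff_bijective.1 (Function.Injective.of_comp hinj)
  · right
    exact ⟨n + 1, LinearMap.range_eq_bot.1 h⟩

lemma IsIndecomposable.bijective_one_sub [Finite X] (hX : IsIndecomposable R X)
    {f : Module.End R X} (hf : ¬ Function.Bijective f) :
    Function.Bijective (1 - f : Module.End R X) :=
  (Module.End.isUnit_iff _).1 ((hX.bijective_or_isNilpotent f).resolve_left hf).isUnit_one_sub

/-- If hg is an isomorphism, then Y is the direct sum of the image of g and the kernel of h, and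
indecomposability kills the kernel. So non-bijective morphisms between indecomposables form an ideal
under composition. -/
lemma bijective_of_bijective_comp [Nontrivial X] (hY : IsIndecomposable R Y) {g : X →ₗ[R] Y}
    {h : Y →ₗ[R] Z} (hb : Function.Bijective (h ∘ₗ g)) :
    Function.Bijective g ∧ Function.Bijective h := by
  have hg : Function.Injective g := Function.Injective.of_comp hb.1
  have hh : Function.Surjective h := Function.Surjective.of_comp hb.2
  have hc : IsCompl (LinearMap.range g) (LinearMap.ker h) := by
    constructor
    · rw [Submodule.disjoint_def]
      rintro _ ⟨x, rfl⟩ hx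
      rw [hb.1 (a₁ := x) (a₂ := 0) (by simpa using hx), map_zero]
    · rw [codisjoint_iff, eq_top_iff]
      intro y _
      obtain ⟨x, hx⟩ := hb.2 (h y)
      rw [← add_sub_cancel (g x) y]
      refine Submodule.add_mem_sup ⟨x, rfl⟩ ?_
      rw [LinearMap.mem_ker, map_sub, sub_eq_zero]
      exact hx.symm
  have hrange : LinearMap.range g ≠ ⊥ := by
    intro h0
    rw [LinearMap.range_eq_bot] at h0
    obtain ⟨x, y, hxy⟩ := exists_pair_ne X
    exact hxy (hg (by rw [h0]; rfl))
  have hker : LinearMap.ker h = ⊥ := (hY.2 _ _ hc).resolve_left hrange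
  have htop : LinearMap.range g = ⊤ := by
    have := hc.sup_eq_top
    rwa [hker, sup_bot_eq] at this
  exact ⟨⟨hg, LinearMap.range_eq_top.1 htop⟩, LinearMap.ker_eq_bot.1 hker, hh⟩

lemma not_bijective_zero [Nontrivial X] : ¬ Function.Bijective (0 : X →ₗ[R] Y) := by
  intro h
  obtain ⟨x, y, hxy⟩ := exists_pair_ne X
  exact hxy (h.1 rfl)

/-- Composing with the inverse of f + g turns the sum into the identity, and the claim becomes
locality of End(X). -/
lemma not_bijective_add [Finite X] (hX : IsIndecomposable R X) {f g : X →ₗ[R] Y}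
    (hf : ¬ Function.Bijective f) (hg : ¬ Function.Bijective g) :
    ¬ Function.Bijective (f + g) := by
  intro hb
  let e := LinearEquiv.ofBijective (f + g) hb
  have hcancel : ∀ k : X →ₗ[R] Y,
      Function.Bijective (e.symm.toLinearMap ∘ₗ k) → Function.Bijective k := by
    intro k hk
    rw [LinearMap.coe_comp] at hk
    exact (Function.Bijective.of_comp_iff' e.symm.bijective _).1 hk
  have hsum : (e.symm.toLinearMap ∘ₗ g : Module.End R X) = 1 - e.symm.toLinearMap ∘ₗ f := by
    ext x
    change e.symm (g x) = x - e.symm (f x)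
    rw [eq_sub_iff_add_eq, ← map_add, add_comm]
    exact e.symm_apply_apply x
  apply hg
  apply hcancel
  rw [hsum]
  exact hX.bijective_one_sub fun h => hf (hcancel f h)

lemma mem_jacobson_end_iff [Finite X] (hX : IsIndecomposable R X) {f : Module.End R X} :
    f ∈ Ring.jacobson (Module.End R X) ↔ ¬ Function.Bijective f := by
  have := hX.1
  constructor
  · intro hu hb
    exact (Ring.jacobson_lt_top (Module.End R X)).ne
      (Ideal.eq_top_of_isUnit_mem _ hu ((Module.End.isUnit_iff f).2 hb))
  · intro hf
    rw [Ring.jacobson_eq_sInf_isMaximal, Submodule.mem_sInf]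
    intro m hm
    have hm : Ideal.IsMaximal m := hm
    by_contra hfm
    -- A maximal left ideal missing f would write 1 as rf + y, a sum of two non-bijective maps.
    obtain ⟨r, y, hy, h1⟩ := hm.exists_inv hfm
    refine not_bijective_add hX (f := r * f) (g := y) ?_ ?_ ?_
    · intro h; exact hf (bijective_of_bijective_comp hX h).1
    · intro h
      exact hm.ne_top (Ideal.eq_top_of_isUnit_mem _ hy ((Module.End.isUnit_iff y).2 h))
    · rw [h1]; exact Function.bijective_id

/-- The residue ring of a finite indecomposable module is a division ring. -/
@[reducible] def residueDivisionRing [Finite X] (hX : IsIndecomposable R X) :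
    DivisionRing (Module.End R X ⧸ Ring.jacobson (Module.End R X)) :=
  haveI := hX.1
  haveI : Nontrivial (Module.End R X ⧸ Ring.jacobson (Module.End R X)) :=
    Ideal.Quotient.nontrivial_iff.2 (Ring.jacobson_lt_top _).ne
  DivisionRing.ofIsUnitOrEqZero fun x => by
    obtain ⟨f, rfl⟩ := Ideal.Quotient.mk_surjective x
    by_cases hf : Function.Bijective f
    · exact Or.inl (((Module.End.isUnit_iff f).2 hf).map _)
    · exact Or.inr (Ideal.Quotient.eq_zero_iff_mem.2 ((mem_jacobson_end_iff hX).2 hf))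

instance finite_linearMap [Finite X] [Finite Y] : Finite (X →ₗ[R] Y) :=
  Finite.of_injective _ DFunLike.coe_injective

/-- Endomorphisms of a finite indecomposable module commute modulo the radical. -/
lemma not_bijective_commutator [Finite X] (hX : IsIndecomposable R X) (f g : Module.End R X) :
    ¬ Function.Bijective (f * g - g * f) := by
  let := residueDivisionRing hX
  rw [← mem_jacobson_end_iff hX, ← Ideal.Quotient.eq_zero_iff_mem, map_sub, map_mul, map_mul,
    sub_eq_zero]
  have : Finite (Module.End R X ⧸ Ring.jacobson (Module.End R X)) :=
    Finite.of_surjective _ Ideal.Quotient.mk_surjective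
  let := littleWedderburn (Module.End R X ⧸ Ring.jacobson (Module.End R X))
  exact mul_comm (Ideal.Quotient.mk (Ring.jacobson (Module.End R X)) f) _

end Indecomposable

/-! ### Entries of endomorphisms of `⨁ᵢ Nᵢ ^ aᵢ` -/

section Entries

variable {R : Type u} [Ring R] {ι : Type} {N : ι → Type v}
  [∀ i, AddCommGroup (N i)] [∀ i, Module R (N i)] {a : ι → ℕ}

/-- The indecomposable summands of `⨁ᵢ Nᵢ ^ aᵢ`. -/
abbrev Slot (a : ι → ℕ) : Type := (i : ι) × Fin (a i)

variable (R N) in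
/-- The projection to a summand. -/
def prj (y : Slot a) : BigModule N a →ₗ[R] N y.1 :=
  LinearMap.proj (R := R) (φ := fun _ : Fin (a y.1) => N y.1) y.2 ∘ₗ
    LinearMap.proj (R := R) (φ := fun i => Fin (a i) → N i) y.1

lemma ext_prj {m m' : BigModule N a} (h : ∀ y, prj R N y m = prj R N y m') : m = m' := by
  funext i s
  exact h ⟨i, s⟩

@[simp] lemma prj_apply (y : Slot a) (m : BigModule N a) : prj R N y m = m y.1 y.2 := rfl

variable [DecidableEq ι]

variable (R N) in
/-- The inclusion of a summand. -/
def inc (y : Slot a) : N y.1 →ₗ[R] BigModule N a :=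
  LinearMap.single R (fun i => Fin (a i) → N i) y.1 ∘ₗ LinearMap.single R (fun _ => N y.1) y.2

lemma prj_inc_self (y : Slot a) : prj R N y ∘ₗ inc R N y = LinearMap.id := by
  ext m
  simp [inc]

lemma prj_inc_of_ne {y z : Slot a} (h : y ≠ z) : prj R N y ∘ₗ inc R N z = 0 := by
  ext m
  obtain ⟨i, s⟩ := y
  obtain ⟨j, t⟩ := z
  by_cases hij : i = j
  · subst hij
    have hst : s ≠ t := fun hst => h (by rw [hst])
    simp [inc, Pi.single_eq_of_ne hst]
  · simp [inc, Pi.single_eq_of_ne hij]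

lemma prj_inc_apply_self (y : Slot a) (m : N y.1) : prj R N y (inc R N y m) = m :=
  LinearMap.congr_fun (prj_inc_self y) m

lemma prj_inc_apply_of_ne {y z : Slot a} (h : y ≠ z) (m : N z.1) : prj R N y (inc R N z m) = 0 :=
  LinearMap.congr_fun (prj_inc_of_ne h) m

lemma inc_injective (y : Slot a) : Function.Injective (inc R N y) :=
  Function.LeftInverse.injective (prj_inc_apply_self y)

lemma inc_comp_ne_zero {X : Type*} [AddCommGroup X] [Module R X] (y : Slot a) {f : X →ₗ[R] N y.1}
    (hf : f ≠ 0) : inc R N y ∘ₗ f ≠ 0 := by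
  intro h
  apply hf
  ext m
  exact inc_injective (R := R) y ((LinearMap.congr_fun h m).trans (map_zero _).symm)

variable [Fintype ι]

lemma sum_inc_prj_apply (m : BigModule N a) : ∑ y : Slot a, inc R N y (prj R N y m) = m := by
  refine ext_prj (R := R) fun z => ?_
  rw [map_sum, Finset.sum_eq_single z, prj_inc_apply_self]
  · intro y _ hy
    exact prj_inc_apply_of_ne hy.symm _
  · simp

lemma linearMap_ext_inc {X : Type*} [AddCommGroup X] [Module R X] {f g : BigModule N a →ₗ[R] X}
    (h : ∀ y, f ∘ₗ inc R N y = g ∘ₗ inc R N y) : f = g := by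
  refine LinearMap.ext fun m => ?_
  rw [← sum_inc_prj_apply (R := R) m, map_sum, map_sum]
  exact Finset.sum_congr rfl fun y _ => LinearMap.congr_fun (h y) _

/-- An endomorphism of `⨁ᵢ Nᵢ ^ aᵢ` all of whose entries are non-bijective is contained in the
radical. -/
lemma bijective_one_sub_of_entries [∀ i, Finite (N i)] (hN : ∀ i, IsIndecomposable R (N i))
    (u : Module.End R (BigModule N a))
    (hu : ∀ y z, ¬ Function.Bijective (prj R N y ∘ₗ u ∘ₗ inc R N z)) :
    Function.Bijective (1 - u : Module.End R (BigModule N a)) := by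
  have hnt := fun i => (hN i).1
  -- Gaussian elimination
  have key : ∀ (S : Finset (Slot a)) (c : ∀ y z : Slot a, N z.1 →ₗ[R] N y.1)
      (_ : ∀ y z, ¬ Function.Bijective (c y z)) (m : ∀ y : Slot a, N y.1)
      (_ : ∀ y ∈ S, m y = ∑ z ∈ S, c y z (m z)), ∀ y ∈ S, m y = 0 := by
    intro S
    induction S using Finset.induction_on with
    | empty => simp
    | insert x S hx ih =>
      intro c hc m hm
      -- The pivot 1 - c x x is invertible by Fitting's lemma, so the equation of row x can be
      -- solved for m x. Substitution changes c y z by c y x ∘ e⁻¹ ∘ c x z, which keeps all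
      -- coefficients non-bijective.
      let e : N x.1 ≃ₗ[R] N x.1 :=
        LinearEquiv.ofBijective _ ((hN x.1).bijective_one_sub (f := c x x) (hc x x))
      have hmx : m x = e.symm (∑ z ∈ S, c x z (m z)) := by
        rw [LinearEquiv.eq_symm_apply]
        have := hm x (Finset.mem_insert_self _ _)
        rw [Finset.sum_insert hx] at this
        change m x - c x x (m x) = _
        rw [sub_eq_iff_eq_add']
        exact this
      have hS : ∀ y ∈ S, m y = 0 := by
        refine ih (fun y z => c y z + c y x ∘ₗ e.symm.toLinearMap ∘ₗ c x z) ?_ m ?_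
        · intro y z
          refine not_bijective_add (hN z.1) (hc y z) fun h => ?_
          exact hc y x (bijective_of_bijective_comp (hN x.1) h).2
        · intro y hy
          rw [hm y (Finset.mem_insert_of_mem hy), Finset.sum_insert hx]
          simp only [LinearMap.add_apply, Finset.sum_add_distrib, LinearMap.comp_apply]
          rw [← map_sum, LinearEquiv.coe_coe, ← map_sum, ← hmx, add_comm]
      intro y hy
      rcases Finset.mem_insert.1 hy with rfl | hy
      · rw [hmx, Finset.sum_eq_zero fun z hz => by rw [hS z hz, map_zero], map_zero]
      · exact hS y hy
  refine Finite.injective_iff_bijective.1 ((injective_iff_map_eq_zero _).2 fun m hm => ?_)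
  refine ext_prj (R := R) fun y => ?_
  rw [map_zero]
  have hm' : m = u m := sub_eq_zero.1 hm
  refine key Finset.univ (fun y z => prj R N y ∘ₗ u ∘ₗ inc R N z) hu (fun y => prj R N y m) ?_ y
    (Finset.mem_univ y)
  intro y _
  conv_lhs => rw [hm', ← sum_inc_prj_apply (R := R) m, map_sum, map_sum]
  rfl

end Entries

/-! ### Morphisms killed by all non-bijective morphisms -/

section Socle

variable {R : Type u} [Ring R] {ι : Type} {N : ι → Type v}
  [∀ i, AddCommGroup (N i)] [∀ i, Module R (N i)]

lemma not_bijective_comp_left {i k l : ι} (hN : ∀ i, IsIndecomposable R (N i))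
    {g : N k →ₗ[R] N l} (hg : ¬ Function.Bijective g) (f : N i →ₗ[R] N k) :
    ¬ Function.Bijective (g ∘ₗ f) := fun h =>
  haveI := (hN i).1
  hg (bijective_of_bijective_comp (hN k) h).2

lemma not_bijective_comp_right {i k l : ι} (hN : ∀ i, IsIndecomposable R (N i))
    (g : N k →ₗ[R] N l) {f : N i →ₗ[R] N k} (hf : ¬ Function.Bijective f) :
    ¬ Function.Bijective (g ∘ₗ f) := fun h =>
  haveI := (hN i).1
  hf (bijective_of_bijective_comp (hN k) h).1

/-- The morphisms `X → Nᵢ` that are killed by every non-bijective morphism out of `Nᵢ`. -/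
def socle (hN : ∀ i, IsIndecomposable R (N i)) (X : Type v) [AddCommGroup X] [Module R X] (i : ι) :
    Submodule (Module.End R (N i)) (X →ₗ[R] N i) where
  carrier := {f | ∀ (k : ι) (g : N i →ₗ[R] N k), ¬ Function.Bijective g → g ∘ₗ f = 0}
  zero_mem' k g _ := LinearMap.comp_zero g
  add_mem' hf hf' k g hg := by rw [LinearMap.comp_add, hf k g hg, hf' k g hg, add_zero]
  smul_mem' e f hf k g hg :=
    hf k (g ∘ₗ e) (not_bijective_comp_left hN hg e)

variable {hN : ∀ i, IsIndecomposable R (N i)} {X : Type v} [AddCommGroup X] [Module R X]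

lemma isTorsion_socle [∀ i, Finite (N i)] (i : ι) : Module.IsTorsionBySet (Module.End R (N i))
    (socle hN X i) (Ring.jacobson (Module.End R (N i)) : Ideal (Module.End R (N i))) := by
  rintro ⟨f, hf⟩ ⟨u, hu⟩
  exact Subtype.ext (hf i u ((mem_jacobson_end_iff (hN i)).1 hu))

/-- Being non-bijective and being killed by all non-bijective maps are each stable under sums and
postcomposition, so passing to the span creates nothing new. -/
lemma mem_LM_iff [∀ i, Finite (N i)] (hN : ∀ i, IsIndecomposable R (N i)) {j i : ι}
    {f : N j →ₗ[R] N i} : f ∈ LM R N j i ↔ ¬ Function.Bijective f ∧ f ∈ socle hN (N j) i := by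
  have := (hN j).1
  constructor
  · intro hf
    unfold LM at hf
    induction hf using Submodule.span_induction with
    | mem f hf => exact hf.2
    | zero => exact ⟨not_bijective_zero, zero_mem _⟩
    | add f g _ _ h1 h2 => exact ⟨not_bijective_add (hN j) h1.1 h2.1, add_mem h1.2 h2.2⟩
    | smul e f _ h => exact ⟨not_bijective_comp_right hN e h.1, (socle hN (N j) i).smul_mem e h.2⟩
  · rintro ⟨h1, h2⟩
    by_cases h0 : f = 0
    · rw [h0]; exact zero_mem _
    · exact Submodule.subset_span ⟨h0, h1, h2⟩

lemma isLeftMaximal_of_mem_LM [∀ i, Finite (N i)] (hN : ∀ i, IsIndecomposable R (N i)) {j i : ι}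
    {f : N j →ₗ[R] N i} (hf : f ∈ LM R N j i) (h0 : f ≠ 0) : IsLeftMaximal N f :=
  ⟨h0, (mem_LM_iff hN).1 hf⟩

instance finite_residue [∀ i, Finite (N i)] (i : ι) : Finite (Residue R N i) :=
  Finite.of_surjective _ Ideal.Quotient.mk_surjective

lemma one_lt_card_residue [∀ i, Finite (N i)] (hN : ∀ i, IsIndecomposable R (N i)) (i : ι) :
    1 < Nat.card (Residue R N i) := by
  let := residueDivisionRing (hN i)
  exact Finite.one_lt_card

lemma card_LM [∀ i, Finite (N i)] (hN : ∀ i, IsIndecomposable R (N i)) (j i : ι) :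
    Nat.card (LM R N j i) = Nat.card (Residue R N i) ^ numArrows R N j i := by
  let := residueDivisionRing (hN i)
  let := Fintype.ofFinite (Residue R N i)
  let := Fintype.ofFinite (LM R N j i)
  rw [Nat.card_eq_fintype_card, Nat.card_eq_fintype_card]
  exact Module.card_eq_pow_finrank (K := Residue R N i) (V := LM R N j i)

lemma numArrows_ne_zero_iff [∀ i, Finite (N i)] (hN : ∀ i, IsIndecomposable R (N i)) {j i : ι} :
    numArrows R N j i ≠ 0 ↔ ∃ f ∈ LM R N j i, f ≠ 0 := by
  have hcard := card_LM hN j i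
  constructor
  · intro h
    by_contra! hcon
    have hbot : Subsingleton (LM R N j i) :=
      ⟨fun f g => Subtype.ext ((hcon f f.2).trans (hcon g g.2).symm)⟩
    rw [Nat.card_unique] at hcard
    exact (Nat.one_lt_pow h (one_lt_card_residue hN i)).ne hcard
  · rintro ⟨f, hf, h0⟩ h
    rw [h, pow_zero, Nat.card_eq_one_iff_unique] at hcard
    have := hcard.1
    exact h0 (congrArg Subtype.val (Subsingleton.elim (⟨f, hf⟩ : LM R N j i) 0))

end Socle

/-! ### Consequences of not occurring in smaller functors -/

section RankBound

variable {A : Type w} [CommRing A] {R : Type u} [Ring R] [Algebra A R]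
  {ι : Type} {N : ι → Type v} [∀ i, AddCommGroup (N i)] [∀ i, Module R (N i)] {a : ι → ℕ}
  {K : Type*} [Field K] {V : Type*} [AddCommGroup V] [Module K V]
  {ρ : Representation K (BigModule N a ≃ₗ[R] BigModule N a) V}

variable (A) in
/-- `ρ` occurs in no `KG(M)` with `G ≺ Hom(M, -)`. -/
def AvoidsProperQuotients (ρ : Representation K (BigModule N a ≃ₗ[R] BigModule N a) V) : Prop :=
  ∀ G : FunCat A R N, IsProperSubquotient G (homFunctor A R N a) →
    ∀ T : (permRep K a G).IntertwiningMap ρ, T = 0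

open Classical in
/-- The equivariant function on `End(M)` that is the orbit map of `v` on the automorphisms and
vanishes on non-invertible elements. -/
def orbitFun (ρ : Representation K (BigModule N a ≃ₗ[R] BigModule N a) V) (v : V)
    (e : Module.End R (BigModule N a)) : V :=
  if h : Function.Bijective e then ρ (LinearEquiv.ofBijective e h) v else 0

lemma orbitFun_coe (v : V) (g : BigModule N a ≃ₗ[R] BigModule N a) :
    orbitFun ρ v (g : BigModule N a →ₗ[R] BigModule N a) = ρ g v := by
  exact (dif_pos g.bijective).trans (by congr 2; exact LinearEquiv.ext fun _ => rfl)

lemma orbitFun_comp (v : V) (g : BigModule N a ≃ₗ[R] BigModule N a)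
    (e : Module.End R (BigModule N a)) :
    orbitFun ρ v ((g : BigModule N a →ₗ[R] BigModule N a) ∘ₗ e) = ρ g (orbitFun ρ v e) := by
  by_cases he : Function.Bijective e
  · obtain ⟨h, rfl⟩ : ∃ h : BigModule N a ≃ₗ[R] BigModule N a, e = h :=
      ⟨LinearEquiv.ofBijective e he, rfl⟩
    rw [orbitFun_coe]
    exact (orbitFun_coe v (g * h)).trans (by rw [map_mul]; rfl)
  · have h1 : ¬ Function.Bijective ((g : BigModule N a →ₗ[R] BigModule N a) ∘ₗ e) := fun h =>
      he ((Function.Bijective.of_comp_iff' g.bijective _).1 h)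
    rw [orbitFun, dif_neg h1, orbitFun, dif_neg he, map_zero]

/-- No non-zero vector is fixed by `1 + L`, for `L` a non-zero left ideal with `1 + L` contained
in the automorphism group. -/
lemma eq_zero_of_fixed_by_one_add_ideal [Finite ι] [∀ i, Finite (N i)]
    (hρ : AvoidsProperQuotients A ρ) {L : Ideal (Module.End R (BigModule N a))} (hL : L ≠ ⊥)
    (hunit : ∀ l ∈ L, Function.Bijective (1 + l : Module.End R (BigModule N a))) (v : V)
    (hv : ∀ g : BigModule N a ≃ₗ[R] BigModule N a,
      ((g : BigModule N a →ₗ[R] BigModule N a) - 1 : Module.End R (BigModule N a)) ∈ L →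
        ρ g v = v) : v = 0 := by
  -- Factor g + l = g(1 + g⁻¹l); as L is a left ideal, the second factor lies in 1 + L. Thus
  -- translation by L preserves units and non-units, and on units it changes g only by an element
  -- fixing v.
  have hbij : ∀ (g : BigModule N a ≃ₗ[R] BigModule N a), ∀ l ∈ L,
      ∃ h : BigModule N a ≃ₗ[R] BigModule N a,
        ((h : BigModule N a →ₗ[R] BigModule N a) - 1 : Module.End R (BigModule N a)) ∈ L ∧
        (g : BigModule N a →ₗ[R] BigModule N a) + l =
          (g * h : BigModule N a ≃ₗ[R] BigModule N a) := by
    intro g l hl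
    have hl' := L.mul_mem_left ((g⁻¹ : BigModule N a ≃ₗ[R] BigModule N a) :
      Module.End R (BigModule N a)) hl
    refine ⟨LinearEquiv.ofBijective _ (hunit _ hl'), ?_, ?_⟩
    · change (1 + _ - 1 : Module.End R (BigModule N a)) ∈ L
      rwa [add_sub_cancel_left]
    · ext1 m
      change g m + l m = g (m + g.symm (l m))
      rw [map_add, g.apply_symm_apply]
  have h0 := eq_zero_of_translation_invariant hρ hL (orbitFun ρ v) (orbitFun_comp v) (by
    intro e l hl
    by_cases he : Function.Bijective e
    · obtain ⟨g, rfl⟩ : ∃ h : BigModule N a ≃ₗ[R] BigModule N a, e = h :=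
        ⟨LinearEquiv.ofBijective e he, rfl⟩
      obtain ⟨h, hh, heq⟩ := hbij g l hl
      rw [heq, orbitFun_coe, orbitFun_coe, map_mul, Module.End.mul_apply, hv h hh]
    · have he' : ¬ Function.Bijective (e + l : Module.End R (BigModule N a)) := by
        intro h
        obtain ⟨h', -, heq⟩ := hbij (LinearEquiv.ofBijective _ h) (-l) (L.neg_mem hl)
        apply he
        have : e = (LinearEquiv.ofBijective _ h * h' : BigModule N a ≃ₗ[R] BigModule N a) := by
          rw [← heq]
          exact (add_neg_cancel_right e l).symm
        rw [this]
        exact LinearEquiv.bijective _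
      rw [orbitFun, dif_neg he', orbitFun, dif_neg he])
  have h1 := orbitFun_coe (ρ := ρ) v 1
  rw [h0, map_one] at h1
  exact h1.symm

/-- The left ideal of `End(M)` of the morphisms factoring through `f`. -/
def factorIdeal {X : Type v} [AddCommGroup X] [Module R X] (f : BigModule N a →ₗ[R] X) :
    Ideal (Module.End R (BigModule N a)) where
  carrier := {u | ∃ φ : X →ₗ[R] BigModule N a, u = φ ∘ₗ f}
  zero_mem' := ⟨0, (LinearMap.zero_comp f).symm⟩
  add_mem' := by
    rintro _ _ ⟨φ, rfl⟩ ⟨φ', rfl⟩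
    exact ⟨φ + φ', (LinearMap.add_comp f φ' φ).symm⟩
  smul_mem' := by
    rintro e _ ⟨φ, rfl⟩
    exact ⟨e ∘ₗ φ, rfl⟩

variable [IsAlgClosed K] [CharZero K]

/-- If every character of `End(M)` is trivial on a non-zero left ideal, then `ρ` is zero. -/
lemma subsingleton_of_forall_addChar [Finite ι] [∀ i, Finite (N i)]
    (hρ : AvoidsProperQuotients A ρ)
    (h : ∀ χ : AddChar (Module.End R (BigModule N a)) K,
      ∃ L : Ideal (Module.End R (BigModule N a)), L ≠ ⊥ ∧ ∀ l ∈ L, χ l = 1) :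
    Subsingleton V := by
  have := Fintype.ofFinite (Module.End R (BigModule N a))
  refine subsingleton_of_forall_eq 0 fun v => ?_
  have h0 : orbitFun ρ v = 0 := by
    refine eq_zero_of_fourier_eq_zero (K := K) _ fun χ => ?_
    obtain ⟨L, hL, hχ⟩ := h χ
    have := Fintype.ofFinite L
    -- Summing over translates by L makes the orbit function L-invariant, hence zero; it stays
    -- equivariant because l ↦ g⁻¹l permutes L. Since χ is trivial on L, the Fourier coefficient of
    -- the sum is |L| times the original one.
    have h1 : (fun e => ∑ l : L, orbitFun ρ v (e + l)) = 0 := by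
      refine eq_zero_of_translation_invariant hρ hL _ ?_ ?_
      · intro g e
        rw [map_sum]
        simp_rw [← orbitFun_comp, LinearMap.comp_add]
        refine Fintype.sum_bijective
          (fun l : L => (⟨(((g⁻¹ : BigModule N a ≃ₗ[R] BigModule N a) :
            Module.End R (BigModule N a)) * l.1), L.mul_mem_left _ l.2⟩ : L)) ?_ _ _ ?_
        · refine Finite.injective_iff_bijective.1 fun l l' hll => Subtype.ext ?_
          ext1 m
          exact g.symm.injective (LinearMap.congr_fun (congrArg Subtype.val hll) m)
        · intro l
          congr 2
          ext1 m
          exact (g.apply_symm_apply _).symm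
      · intro e l hl
        exact Fintype.sum_equiv (Equiv.addLeft (⟨l, hl⟩ : L)) _ _ fun l' => by
          rw [add_assoc]; rfl
    have h2 : ∀ l : L, ∑ u, χ u • orbitFun ρ v (u + l) = ∑ u, χ u • orbitFun ρ v u := fun l =>
      Fintype.sum_equiv (Equiv.addRight l.1) _ _ fun u => by
        rw [Equiv.coe_addRight, AddChar.map_add_eq_mul, hχ l l.2, mul_one]
    have h3 : ∑ l : L, ∑ u, χ u • orbitFun ρ v (u + l) = 0 := by
      rw [Finset.sum_comm]
      simp_rw [← Finset.smul_sum]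
      exact Finset.sum_eq_zero fun u _ => by rw [congrFun h1 u]; exact smul_zero _
    simp_rw [h2, Finset.sum_const, Finset.card_univ] at h3
    rw [← Nat.cast_smul_eq_nsmul K] at h3
    exact (smul_eq_zero.1 h3).resolve_left (Nat.cast_ne_zero.2 Fintype.card_ne_zero)
  have h1 := orbitFun_coe (ρ := ρ) v 1
  rw [h0, map_one] at h1
  exact h1.symm

variable [Fintype ι] [DecidableEq ι]

/-- Components of φ towards other vertices are non-bijective and hence kill f. So φ ∘ f depends only
on the aᵢ components of φ in End(Nᵢ), and these matter only modulo the radical. -/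
lemma comp_socle_eq_sum [∀ i, Finite (N i)] (hN : ∀ i, IsIndecomposable R (N i))
    (hne : ∀ i j, i ≠ j → IsEmpty (N i ≃ₗ[R] N j)) {X : Type v} [AddCommGroup X] [Module R X]
    {i : ι} {f : X →ₗ[R] N i} (hf : f ∈ socle hN X i) (φ : N i →ₗ[R] BigModule N a) :
    φ ∘ₗ f = ∑ s : Fin (a i), inc R N ⟨i, s⟩ ∘ₗ (prj R N ⟨i, s⟩ ∘ₗ φ) ∘ₗ f := by
  have h1 : φ ∘ₗ f = ∑ y : Slot a, inc R N y ∘ₗ (prj R N y ∘ₗ φ) ∘ₗ f := by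
    ext1 x
    rw [LinearMap.sum_apply]
    exact (sum_inc_prj_apply (R := R) (φ (f x))).symm
  rw [h1, Fintype.sum_sigma, Finset.sum_eq_single i]
  · intro j _ hji
    refine Finset.sum_eq_zero fun s _ => ?_
    rw [hf j _ fun hb => (hne i j hji.symm).false (LinearEquiv.ofBijective _ hb),
      LinearMap.comp_zero]
  · simp

/-- A character χ of End(M) pairs f in the socle with e ∈ Eᵢ^{aᵢ} by evaluating χ on the composite
of f with the column e. By `comp_socle_eq_sum` these composites form the whole left ideal of maps
factoring through f. If the socle were larger than Eᵢ^{aᵢ}, some f ≠ 0 would pair trivially, so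
every χ would be trivial on a non-zero left ideal, contradicting V ≠ 0. -/
lemma card_socle_le [∀ i, Finite (N i)] [Nontrivial V] (hρ : AvoidsProperQuotients A ρ)
    (hN : ∀ i, IsIndecomposable R (N i)) (hne : ∀ i j, i ≠ j → IsEmpty (N i ≃ₗ[R] N j))
    (ha : ∀ i, 0 < a i) (i : ι) :
    Nat.card (socle hN (BigModule N a) i) ≤ Nat.card (Residue R N i) ^ a i := by
  by_contra! hlt
  refine not_subsingleton V (subsingleton_of_forall_addChar (K := K) hρ fun χ => ?_)
  let : Module (Residue R N i) (socle hN (BigModule N a) i) := (isTorsion_socle i).module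
  have hadd : ∀ (e e' : Fin (a i) → Residue R N i) (f : socle hN (BigModule N a) i),
      (∑ s, inc R N ⟨i, s⟩ ∘ₗ ((e + e') s • f).1 : Module.End R (BigModule N a)) =
      ∑ s, inc R N ⟨i, s⟩ ∘ₗ (e s • f).1 + ∑ s, inc R N ⟨i, s⟩ ∘ₗ (e' s • f).1 := by
    intro e e' f
    rw [← Finset.sum_add_distrib]
    refine Finset.sum_congr rfl fun s _ => ?_
    rw [Pi.add_apply, add_smul, Submodule.coe_add, LinearMap.comp_add]
  have hadd' : ∀ (e : Fin (a i) → Residue R N i) (f f' : socle hN (BigModule N a) i),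
      (∑ s, inc R N ⟨i, s⟩ ∘ₗ (e s • (f + f')).1 : Module.End R (BigModule N a)) =
      ∑ s, inc R N ⟨i, s⟩ ∘ₗ (e s • f).1 + ∑ s, inc R N ⟨i, s⟩ ∘ₗ (e s • f').1 := by
    intro e f f'
    rw [← Finset.sum_add_distrib]
    refine Finset.sum_congr rfl fun s _ => ?_
    rw [smul_add, Submodule.coe_add, LinearMap.comp_add]
  let β : socle hN (BigModule N a) i →+ AddChar (Fin (a i) → Residue R N i) K :=
    AddMonoidHom.mk' (fun f =>
      { toFun := fun e => χ (∑ s, inc R N ⟨i, s⟩ ∘ₗ (e s • f).1)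
        map_zero_eq_one' := by
          rw [Finset.sum_eq_zero, AddChar.map_zero_eq_one]
          intro s _
          rw [Pi.zero_apply, zero_smul, Submodule.coe_zero, LinearMap.comp_zero]
        map_add_eq_mul' := fun e e' => by rw [hadd, AddChar.map_add_eq_mul] })
      (fun f f' => by
        ext e
        change χ _ = χ _ * χ _
        rw [hadd', AddChar.map_add_eq_mul])
  obtain ⟨f, hf0, hf⟩ := exists_forall_eq_one_of_card_lt β (by
    rwa [Nat.card_fun, Nat.card_eq_fintype_card (α := Fin (a i)), Fintype.card_fin])
  refine ⟨factorIdeal f.1, ?_, ?_⟩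
  · rw [Submodule.ne_bot_iff]
    exact ⟨_, ⟨inc R N ⟨i, ⟨0, ha i⟩⟩, rfl⟩,
      inc_comp_ne_zero ⟨i, ⟨0, ha i⟩⟩ fun h => hf0 (Subtype.ext h)⟩
  · rintro _ ⟨φ, rfl⟩
    rw [comp_socle_eq_sum hN hne f.2 φ]
    exact hf fun s => Ideal.Quotient.mk _ (prj R N ⟨i, s⟩ ∘ₗ φ)

/-- The weighted in-degrees of the left maximal graph are bounded by the multiplicities. -/
lemma sum_numArrows_mul_le [∀ i, Finite (N i)] [Nontrivial V] (hρ : AvoidsProperQuotients A ρ)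
    (hN : ∀ i, IsIndecomposable R (N i)) (hne : ∀ i j, i ≠ j → IsEmpty (N i ≃ₗ[R] N j))
    (ha : ∀ i, 0 < a i) (i : ι) :
    ∑ j, numArrows R N j i * a j ≤ a i := by
  have h1 := card_socle_le hρ hN hne ha i
  -- A row of left maximal entries, one for each summand of M, is a morphism in the socle; each
  -- vertex j contributes a j copies of LM(N_j, Nᵢ).
  let Φ : (∀ y : Slot a, LM R N y.1 i) → socle hN (BigModule N a) i := fun h =>
    ⟨∑ y, (h y).1 ∘ₗ prj R N y, Submodule.sum_mem _ fun y _ k g hg => by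
      rw [← LinearMap.comp_assoc, ((mem_LM_iff hN).1 (h y).2).2 k g hg, LinearMap.zero_comp]⟩
  have hΦ : Function.Injective Φ := by
    intro h h' hh
    funext z
    apply Subtype.ext
    have key : ∀ h : ∀ y : Slot a, LM R N y.1 i, (Φ h).1 ∘ₗ inc R N z = (h z).1 := by
      intro h
      change (∑ y, (h y).1 ∘ₗ prj R N y) ∘ₗ inc R N z = (h z).1
      ext1 m
      rw [LinearMap.comp_apply, LinearMap.sum_apply, Finset.sum_eq_single z]
      · rw [LinearMap.comp_apply, prj_inc_apply_self]
      · intro y _ hy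
        rw [LinearMap.comp_apply, prj_inc_apply_of_ne hy, map_zero]
      · simp
    rw [← key h, ← key h', hh]
  have h2 := Nat.card_le_card_of_injective Φ hΦ
  rw [Nat.card_pi, Fintype.prod_sigma] at h2
  simp_rw [card_LM hN, Finset.prod_const, Finset.card_univ, Fintype.card_fin, ← pow_mul] at h2
  rw [Finset.prod_pow_eq_pow_sum] at h2
  exact (Nat.pow_le_pow_iff_right (one_lt_card_residue hN i)).1 (h2.trans h1)

end RankBound

/-! ### The shape of the left maximal graph -/

section Shape

/-- Weighted in-degrees bounded by the weights and positive out-degrees force the graph to be that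
of a weight-preserving permutation. -/
lemma exists_perm_of_sum_le {ι : Type*} [Fintype ι] [DecidableEq ι] (d : ι → ι → ℕ) (a : ι → ℕ)
    (ha : ∀ i, 0 < a i) (hin : ∀ i, ∑ j, d j i * a j ≤ a i) (hout : ∀ j, ∃ i, d j i ≠ 0) :
    ∃ s : Equiv.Perm ι, (∀ j i, d j i = if i = s j then 1 else 0) ∧ ∀ j, a (s j) = a j := by
  have hge : ∀ j, a j ≤ ∑ i, d j i * a j := by
    intro j
    obtain ⟨i, hi⟩ := hout j
    calc a j ≤ d j i * a j := Nat.le_mul_of_pos_left _ (Nat.pos_of_ne_zero hi)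
      _ ≤ _ := Finset.single_le_sum (f := fun i => d j i * a j) (fun _ _ => Nat.zero_le _)
        (Finset.mem_univ i)
  -- The chain ∑ a j ≤ weighted out-degrees = weighted in-degrees ≤ ∑ a i closes up, so every
  -- individual inequality is an equality.
  have hswap : ∑ i, ∑ j, d j i * a j = ∑ j, ∑ i, d j i * a j := Finset.sum_comm
  have hle1 : ∑ i, ∑ j, d j i * a j ≤ ∑ i, a i := Finset.sum_le_sum fun i _ => hin i
  have hle2 : ∑ j, a j ≤ ∑ j, ∑ i, d j i * a j := Finset.sum_le_sum fun j _ => hge j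
  have heq1 : ∀ i, ∑ j, d j i * a j = a i := fun i =>
    (Finset.sum_eq_sum_iff_of_le fun i _ => hin i).1 (by omega) i (Finset.mem_univ i)
  have heq2 : ∀ j, ∑ i, d j i = 1 := fun j => by
    have h := (Finset.sum_eq_sum_iff_of_le fun j _ => hge j).1 (by omega) j (Finset.mem_univ j)
    rw [← Finset.sum_mul] at h
    exact Nat.eq_of_mul_eq_mul_right (ha j) (by rw [one_mul]; exact h.symm)
  choose s hs using hout
  have hd : ∀ j i, d j i = if i = s j then 1 else 0 := by
    intro j i
    have h := heq2 j
    rw [← Finset.add_sum_erase _ _ (Finset.mem_univ (s j))] at h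
    have h1 : d j (s j) = 1 := by have := hs j; omega
    split_ifs with hi
    · rw [hi, h1]
    · have h2 : ∑ i ∈ Finset.univ.erase (s j), d j i = 0 := by omega
      exact Finset.sum_eq_zero_iff.1 h2 i (Finset.mem_erase.2 ⟨hi, Finset.mem_univ i⟩)
  have hsurj : Function.Surjective s := by
    intro i
    by_contra! hcon
    have h := heq1 i
    rw [Finset.sum_eq_zero fun j _ => by rw [hd, if_neg (hcon j).symm, zero_mul]] at h
    exact (ha i).ne h
  have hbij : Function.Bijective s := Finite.surjective_iff_bijective.1 hsurj
  refine ⟨Equiv.ofBijective s hbij, hd, fun j => ?_⟩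
  change a (s j) = a j
  rw [← heq1 (s j), Finset.sum_eq_single j]
  · rw [hd, if_pos rfl, one_mul]
  · intro j' _ hj'
    rw [hd, if_neg fun h => hj' (hbij.1 h).symm, zero_mul]
  · simp

variable {A : Type w} [CommRing A] {R : Type u} [Ring R] [Algebra A R]
  {ι : Type} {N : ι → Type v} [∀ i, AddCommGroup (N i)] [∀ i, Module R (N i)] {a : ι → ℕ}
  [Fintype ι] [DecidableEq ι] [∀ i, Finite (N i)]

/-- A vertex with a non-zero non-bijective morphism out of it has an outgoing arrow. -/
lemma exists_numArrows_ne_zero (hN : ∀ i, IsIndecomposable R (N i)) {j k : ι}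
    {f : N j →ₗ[R] N k} (hf0 : f ≠ 0) (hf : ¬ Function.Bijective f) :
    ∃ i, numArrows R N j i ≠ 0 := by
  -- induction on the size of the set of morphisms from `N j` to `⨁ N i` factoring through `f`
  let fac : ∀ {k : ι}, (N j →ₗ[R] N k) → Set (∀ l, N j →ₗ[R] N l) := fun {k} f =>
    {h | ∃ φ : ∀ l, N k →ₗ[R] N l, ∀ l, h l = φ l ∘ₗ f}
  induction hn : (fac f).ncard using Nat.strong_induction_on generalizing k with
  | _ n ih =>
  by_cases hmax : f ∈ socle hN (N j) k
  · exact ⟨k, (numArrows_ne_zero_iff hN).2 ⟨f, (mem_LM_iff hN).2 ⟨hf, hmax⟩, hf0⟩⟩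
  · obtain ⟨l, g, hg, hgf⟩ : ∃ (l : ι) (g : N k →ₗ[R] N l),
        ¬ Function.Bijective g ∧ g ∘ₗ f ≠ 0 := by
      by_contra! hcon
      exact hmax hcon
    refine ih _ ?_ hgf (not_bijective_comp_left hN hg f) rfl
    rw [← hn]
    refine Set.ncard_lt_ncard (ssubset_of_subset_of_ne ?_ ?_)
    · rintro h ⟨φ, hφ⟩
      exact ⟨fun l' => φ l' ∘ₗ g, hφ⟩
    -- If composing with g lost nothing, f would factor as φ ∘ g ∘ f; but φ ∘ g is non-bijective,
    -- hence nilpotent, and iterating gives f = 0.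
    · intro heq
      have hmem : (fun l' => if h : k = l' then h ▸ f else 0 : ∀ l, N j →ₗ[R] N l) ∈ fac f := by
        refine ⟨fun l' => if h : k = l' then h ▸ LinearMap.id else 0, fun l' => ?_⟩
        by_cases h : k = l'
        · subst h
          simp
        · simp [h]
      rw [← heq] at hmem
      obtain ⟨φ, hφ⟩ := hmem
      have h1 : f = φ k ∘ₗ g ∘ₗ f := by
        have := hφ k
        simpa using this
      have hnil := ((hN k).bijective_or_isNilpotent (φ k ∘ₗ g)).resolve_left
        (not_bijective_comp_right hN (φ k) hg)
      obtain ⟨m, hm⟩ := hnil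
      have hpow : ∀ m : ℕ, f = ((φ k ∘ₗ g : Module.End R (N k)) ^ m) ∘ₗ f := by
        intro m
        induction m with
        | zero => rfl
        | succ m ihm =>
          rw [pow_succ, Module.End.mul_eq_comp, LinearMap.comp_assoc]
          have h2 : (φ k ∘ₗ g) ∘ₗ f = f := h1.symm
          rw [h2]
          exact ihm
      apply hf0
      rw [hpow m, hm, LinearMap.zero_comp]

/-- If there are no non-zero morphisms between `Nᵢ` and the other summands, then automorphisms
split. -/
lemma autSplits_of_hom_eq_zero (hN : ∀ i, IsIndecomposable R (N i)) (ha : ∀ i, 0 < a i) {i j : ι}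
    (hij : i ≠ j) (hfrom : ∀ k, k ≠ i → ∀ f : N i →ₗ[R] N k, f = 0)
    (hto : ∀ k, k ≠ i → ∀ f : N k →ₗ[R] N i, f = 0) : AutSplits R (BigModule N a) := by
  have hnt := fun i => (hN i).1
  let P : Submodule R (BigModule N a) :=
    LinearMap.range (LinearMap.single R (fun i => Fin (a i) → N i) i)
  let Q : Submodule R (BigModule N a) :=
    LinearMap.ker (LinearMap.proj (R := R) (φ := fun i => Fin (a i) → N i) i)
  have hPQ : IsCompl P Q := by
    constructor
    · rw [Submodule.disjoint_def]
      rintro _ ⟨x, rfl⟩ hx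
      have : x = 0 := by simpa [Q] using hx
      rw [this, map_zero]
    · rw [codisjoint_iff, eq_top_iff]
      intro m _
      rw [← add_sub_cancel (LinearMap.single R (fun i => Fin (a i) → N i) i (m i)) m]
      refine Submodule.add_mem_sup ⟨_, rfl⟩ ?_
      simp [Q]
  have hP : ∀ (g : BigModule N a →ₗ[R] BigModule N a), ∀ x ∈ P, g x ∈ P := by
    rintro g _ ⟨x, rfl⟩
    refine ⟨g (LinearMap.single R (fun i => Fin (a i) → N i) i x) i, ?_⟩
    funext k
    by_cases hk : k = i
    · subst hk; simp
    · rw [LinearMap.single_apply, Pi.single_eq_of_ne hk]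
      funext s
      have hz : ∀ t : Fin (a i), (prj R N ⟨k, s⟩ ∘ₗ g ∘ₗ
          LinearMap.single R (fun i => Fin (a i) → N i) i) ∘ₗ
            LinearMap.single R (fun _ => N i) t = 0 := fun t => hfrom k hk _
      have := LinearMap.pi_ext' (f := prj R N ⟨k, s⟩ ∘ₗ g ∘ₗ
          LinearMap.single R (fun i => Fin (a i) → N i) i) (g := 0) fun t => by
        rw [hz t, LinearMap.zero_comp]
      exact (LinearMap.congr_fun this x).symm
  have hQ : ∀ (g : BigModule N a →ₗ[R] BigModule N a), ∀ x ∈ Q, g x ∈ Q := by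
    intro g x hx
    have hx : x i = 0 := hx
    change g x i = 0
    funext s
    have h1 : prj R N ⟨i, s⟩ (g x) = 0 := by
      rw [← sum_inc_prj_apply (R := R) x, map_sum, map_sum]
      refine Finset.sum_eq_zero fun y _ => ?_
      by_cases hy : y.1 = i
      · obtain ⟨k, t⟩ := y
        have hy : k = i := hy
        subst hy
        have h0 : prj R N ⟨k, t⟩ x = 0 := congrFun hx t
        rw [h0, map_zero, map_zero, map_zero]
      · exact LinearMap.congr_fun (hto y.1 hy (prj R N ⟨i, s⟩ ∘ₗ g ∘ₗ inc R N y)) _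
    exact h1
  have hne : ∀ (k : ι) (S : Submodule R (BigModule N a)),
      (∀ m, inc R N (a := a) ⟨k, ⟨0, ha k⟩⟩ m ∈ S) → S ≠ ⊥ := by
    rintro k S hS rfl
    obtain ⟨m, hm⟩ := exists_ne (0 : N k)
    exact hm (inc_injective (R := R) ⟨k, ⟨0, ha k⟩⟩ (((Submodule.mem_bot R).1 (hS m)).trans
      (map_zero _).symm))
  refine ⟨P, Q, hPQ, hne i P fun m => ⟨_, rfl⟩, hne j Q fun m => ?_, fun g => ?_⟩
  · change (inc R N (a := a) ⟨j, ⟨0, ha j⟩⟩ m) i = 0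
    simp [inc, Pi.single_eq_of_ne hij]
  · have hinj : ∀ S : Submodule R (BigModule N a), ∀ h : (∀ x ∈ S, g.toLinearMap x ∈ S),
        Function.Bijective (g.toLinearMap.restrict h) := fun S h =>
      Finite.injective_iff_bijective.1 fun x y hxy =>
        Subtype.ext (g.injective (congrArg Subtype.val hxy))
    exact ⟨LinearEquiv.ofBijective _ (hinj P (hP g)), LinearEquiv.ofBijective _ (hinj Q (hQ g)),
      fun _ => rfl, fun _ => rfl⟩

variable {K : Type*} [Field K] [IsAlgClosed K] [CharZero K] {V : Type*} [AddCommGroup V]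
  [Module K V] [Nontrivial V] {ρ : Representation K (BigModule N a ≃ₗ[R] BigModule N a) V}

/-- If all non-bijective morphisms out of `Nᵢ` vanish, then there are no morphisms to `Nᵢ` from
other summands. -/
lemma eq_zero_of_hom_out_eq_zero (hρ : AvoidsProperQuotients A ρ)
    (hN : ∀ i, IsIndecomposable R (N i)) (hne : ∀ i j, i ≠ j → IsEmpty (N i ≃ₗ[R] N j))
    (ha : ∀ i, 0 < a i) {i j : ι} (hji : j ≠ i)
    (hout : ∀ k (g : N i →ₗ[R] N k), ¬ Function.Bijective g → g = 0) (f : N j →ₗ[R] N i) :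
    f = 0 := by
  have h1 := card_socle_le hρ hN hne ha i
  have h2 : Nat.card (Residue R N i) ≤ Nat.card (Module.End R (N i)) :=
    Nat.card_le_card_of_surjective _ Ideal.Quotient.mk_surjective
  -- The socle is now all of Hom(M, Nᵢ), so the rank bound limits that whole group. The maps
  -- supported on Nᵢ^{aᵢ} already attain the bound, leaving no room for maps from other summands.
  have hall : ∀ f : BigModule N a →ₗ[R] N i, f ∈ socle hN (BigModule N a) i := fun f k g hg => by
    rw [hout k g hg, LinearMap.zero_comp]
  let Φ : (Fin (a i) → Module.End R (N i)) → socle hN (BigModule N a) i := fun e =>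
    ⟨∑ s, e s ∘ₗ prj R N ⟨i, s⟩, hall _⟩
  have hinc : ∀ e t, (Φ e).1 ∘ₗ inc R N ⟨i, t⟩ = e t := by
    intro e t
    change (∑ s, e s ∘ₗ prj R N ⟨i, s⟩) ∘ₗ inc R N ⟨i, t⟩ = e t
    ext1 m
    rw [LinearMap.comp_apply, LinearMap.sum_apply, Finset.sum_eq_single t]
    · rw [LinearMap.comp_apply, prj_inc_apply_self (R := R) (⟨i, t⟩ : Slot a)]
    · intro s _ hs
      rw [LinearMap.comp_apply, prj_inc_apply_of_ne (fun h => hs (by simpa using h)), map_zero]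
    · simp
  have hΦ : Function.Injective Φ := fun e e' h => funext fun t => by
    rw [← hinc e t, ← hinc e' t, h]
  have hcard : Nat.card (socle hN (BigModule N a) i) ≤
      Nat.card (Fin (a i) → Module.End R (N i)) := by
    rw [Nat.card_fun, Nat.card_eq_fintype_card (α := Fin (a i)), Fintype.card_fin]
    exact h1.trans (Nat.pow_le_pow_left h2 _)
  have hsurj : Function.Surjective Φ := (Function.Injective.bijective_of_nat_card_le hΦ hcard).2
  obtain ⟨e, he⟩ := hsurj ⟨f ∘ₗ prj R N ⟨j, ⟨0, ha j⟩⟩, hall _⟩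
  have h3 : (Φ e).1 ∘ₗ inc R N ⟨j, ⟨0, ha j⟩⟩ = f := by
    rw [he]
    change (f ∘ₗ prj R N ⟨j, ⟨0, ha j⟩⟩) ∘ₗ inc R N ⟨j, ⟨0, ha j⟩⟩ = f
    rw [LinearMap.comp_assoc, prj_inc_self (⟨j, ⟨0, ha j⟩⟩ : Slot a), LinearMap.comp_id]
  rw [← h3]
  ext1 m
  change (∑ s, e s ∘ₗ prj R N ⟨i, s⟩) (inc R N ⟨j, ⟨0, ha j⟩⟩ m) = 0
  rw [LinearMap.sum_apply]
  refine Finset.sum_eq_zero fun s _ => ?_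
  rw [LinearMap.comp_apply, prj_inc_apply_of_ne (fun h => hji (congrArg Sigma.fst h).symm),
    map_zero]

end Shape

open scoped TensorProduct

/-! ### Clifford theory for abelian subgroups -/

section Clifford

variable {G K : Type*} {V : Type v} [Group G] [Field K] [AddCommGroup V] [Module K V]
  (ρ : Representation K G V)

/-- A representation is induced from `H` if it is generated by an `H`-stable subspace `W` that is
cut out by a projection killing the translates of `W` by elements outside `H`. -/
lemma isInducedFrom_of_projection [Finite G] (H : Subgroup G) (W : Submodule K V)
    (hW : ∀ h ∈ H, ∀ x ∈ W, ρ h x ∈ W) (hspan : ⨆ g, W.map (ρ g) = ⊤) (P : V →ₗ[K] V)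
    (hP1 : ∀ x ∈ W, P x = x) (hP2 : ∀ g ∉ H, ∀ x ∈ W, P (ρ g x) = 0) : IsInducedFrom ρ H := by
  have hmul : ∀ g g' x, ρ g (ρ g' x) = ρ (g * g') x := fun g g' x => by rw [map_mul]; rfl
  let σ : Representation K H W :=
    { toFun := fun h => (ρ h).restrict (hW h h.2)
      map_one' := by ext x; simp
      map_mul' := fun h h' => by ext x; simp }
  let Φ : Representation.IndV H.subtype σ →ₗ[K] V := Representation.Coinvariants.lift _
    (TensorProduct.lift <| (Finsupp.lift _ _ _ fun g : G => ρ g⁻¹ ∘ₗ W.subtype) ∘ₗ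
      (MonoidAlgebra.coeffLinearEquiv K).toLinearMap)
    fun h ↦ by
      ext g x
      simp [σ]
  have hΦ : ∀ g x, Φ (Representation.IndV.mk H.subtype σ g x) = ρ g⁻¹ x.1 := by
    intro g x
    simp [Φ]
  have := Fintype.ofFinite (G ⧸ H)
  -- The coinvariants identify (hg, hx) with (g, x), so right cosets Hg index the induced space.
  -- Inverses of representatives of G ⧸ H serve as representatives, matching the g⁻¹ in Φ.
  let Ψ : (G ⧸ H → W) →ₗ[K] Representation.IndV H.subtype σ :=
    ∑ q : G ⧸ H, Representation.IndV.mk H.subtype σ q.out⁻¹ ∘ₗ LinearMap.proj q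
  have hΨ : ∀ w, Ψ w = ∑ q, Representation.IndV.mk H.subtype σ q.out⁻¹ (w q) := by
    intro w
    simp only [Ψ, LinearMap.sum_apply]
    rfl
  have hmk : ∀ (h : H) (g : G) (x : W), Representation.IndV.mk H.subtype σ (h.1 * g) (σ h x) =
      Representation.IndV.mk H.subtype σ g x := by
    intro h g x
    have := Representation.Coinvariants.mk_self_apply
      (Representation.tprod ((Representation.leftRegular K G).comp H.subtype) σ) h
      (MonoidAlgebra.single g 1 ⊗ₜ[K] x)
    refine Eq.trans ?_ this
    simp [Representation.IndV.mk]
  have hsurj : LinearMap.range Ψ = ⊤ := by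
    have h0 : (LinearMap.range Ψ).mkQ = 0 := by
      refine Representation.IndV.hom_ext _ _ fun g => LinearMap.ext fun x => ?_
      rw [LinearMap.comp_apply, Submodule.mkQ_apply, LinearMap.zero_comp, LinearMap.zero_apply,
        Submodule.Quotient.mk_eq_zero]
      classical
      obtain ⟨h, hh⟩ := QuotientGroup.mk_out_eq_mul H g⁻¹
      refine ⟨Pi.single (QuotientGroup.mk g⁻¹) (σ h⁻¹ x), ?_⟩
      rw [hΨ, Finset.sum_eq_single (QuotientGroup.mk g⁻¹)]
      · rw [Pi.single_eq_same, hh, mul_inv_rev, inv_inv]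
        exact hmk h⁻¹ g x
      · intro q _ hq
        rw [Pi.single_eq_of_ne hq, map_zero]
      · simp
    rw [← Submodule.ker_mkQ (LinearMap.range Ψ), h0, LinearMap.ker_zero]
  have hinj : Function.Injective Φ := by
    rw [injective_iff_map_eq_zero]
    intro z hz
    obtain ⟨w, rfl⟩ := LinearMap.range_eq_top.1 hsurj z
    have hw : w = 0 := by
      funext q₀
      rw [hΨ, map_sum] at hz
      -- Moving the coset q₀ back to H and projecting isolates the q₀ component of w: P kills the
      -- contributions of all other cosets.
      have h1 := congrArg (fun y => P (ρ q₀.out⁻¹ y)) hz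
      simp only [map_sum, map_zero] at h1
      rw [Finset.sum_eq_single q₀] at h1
      · rw [hΦ, inv_inv, hmul, inv_mul_cancel, map_one,
          Module.End.one_apply, hP1 _ (w q₀).2] at h1
        exact Subtype.ext h1
      · intro q _ hq
        rw [hΦ, inv_inv, hmul]
        refine hP2 _ (fun hmem => hq ?_) _ (w q).2
        rw [← QuotientGroup.out_eq' q, ← QuotientGroup.out_eq' q₀]
        exact (QuotientGroup.eq.2 hmem).symm
      · simp
    rw [hw, map_zero]
  have hrange : LinearMap.range Φ = ⊤ := by
    rw [eq_top_iff, ← hspan]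
    refine iSup_le fun g => ?_
    rintro _ ⟨x, hx, rfl⟩
    exact ⟨Representation.IndV.mk H.subtype σ g⁻¹ ⟨x, hx⟩, by rw [hΦ, inv_inv]⟩
  let e : Representation.IndV H.subtype σ ≃ₗ[K] V :=
    LinearEquiv.ofBijective Φ ⟨hinj, LinearMap.range_eq_top.1 hrange⟩
  refine ⟨W, inferInstance, inferInstance, σ, ⟨(Representation.Equiv.mk e fun g => ?_).symm⟩⟩
  refine Representation.IndV.hom_ext _ _ fun g' => LinearMap.ext fun x => ?_
  change Φ (Representation.ind H.subtype σ g (Representation.IndV.mk _ _ g' x)) =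
    ρ g (Φ (Representation.IndV.mk _ _ g' x))
  rw [Representation.ind_mk, hΦ, hΦ, mul_inv_rev, inv_inv, map_mul]
  rfl

variable {ρ} {B : Type*} [AddCommGroup B] [Finite B] [CharZero K]

/-- A finite abelian group has an eigenvector in every non-zero representation. -/
lemma exists_addChar_eigenvector [IsAlgClosed K] [Nontrivial V] (c : B → G)
    (hc : ∀ u w, c (u + w) = c u * c w) :
    ∃ (χ : AddChar B K) (x : V), x ≠ 0 ∧ ∀ u, ρ (c u) x = χ u • x := by
  have := Fintype.ofFinite B
  obtain ⟨x₀, hx₀⟩ := exists_ne (0 : V)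
  have hc0 : c 0 = 1 := by
    have := hc 0 0
    rwa [add_zero, left_eq_mul] at this
  -- Any non-zero Fourier coefficient of u ↦ ρ(c u)x₀ is an eigenvector, and reindexing the sum
  -- shows its character to be χ⁻¹.
  obtain ⟨χ, hχ⟩ : ∃ χ : AddChar B K, ∑ u, χ u • ρ (c u) x₀ ≠ 0 := by
    by_contra! hcon
    have h0 := congrFun (eq_zero_of_fourier_eq_zero (fun u => ρ (c u) x₀) hcon) 0
    simp only [hc0, map_one, Module.End.one_apply, Pi.zero_apply] at h0
    exact hx₀ h0
  refine ⟨χ⁻¹, _, hχ, fun w => ?_⟩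
  rw [map_sum, Finset.smul_sum]
  refine Fintype.sum_equiv (Equiv.addRight w) _ _ fun u => ?_
  rw [Equiv.coe_addRight, map_smul, ← Module.End.mul_apply, ← map_mul, ← hc, smul_smul,
    AddChar.inv_apply, ← AddChar.map_add_eq_mul, add_comm w u, neg_add_cancel_comm_assoc]

/-- Clifford theory for an abelian normal subgroup parametrized by `c : B → G`: an irreducible
representation in which the character `χ` occurs is induced from the stabilizer of `χ`. -/
lemma isInducedFrom_of_addChar [Finite G] (hρ : ρ.IsIrreducible) (c : B → G) (act : G → B →+ B)
    (hact : ∀ g u, c (act g u) = g * c u * g⁻¹) (χ : AddChar B K) (H : Subgroup G)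
    (hH : ∀ g, g ∈ H ↔ ∀ u, χ (act g u) = χ u) {x₀ : V} (hx₀ : x₀ ≠ 0)
    (hx₀χ : ∀ u, ρ (c u) x₀ = χ u • x₀) : IsInducedFrom ρ H := by
  have := Fintype.ofFinite B
  have hmove : ∀ (g : G) (x : V), (∀ u, ρ (c u) x = χ u • x) →
      ∀ u, ρ (c u) (ρ g x) = χ (act g⁻¹ u) • ρ g x := by
    intro g x hx u
    rw [← map_smul, ← hx, hact, inv_inv, ← Module.End.mul_apply, ← Module.End.mul_apply,
      ← map_mul, ← map_mul, mul_assoc, mul_inv_cancel_left]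
  let W : Submodule K V :=
    { carrier := {x | ∀ u, ρ (c u) x = χ u • x}
      zero_mem' := fun u => by rw [map_zero, smul_zero]
      add_mem' := fun hx hy u => by rw [map_add, hx u, hy u, smul_add]
      smul_mem' := fun r x hx u => by rw [map_smul, hx u, smul_comm] }
  have hBK : (Nat.card B : K) ≠ 0 := Nat.cast_ne_zero.2 Nat.card_pos.ne'
  -- W is the χ-eigenspace and the projection is the character idempotent of χ. Translates of W span
  -- by irreducibility; those outside H carry a different character and are killed by orthogonality.
  refine isInducedFrom_of_projection ρ H W ?_ ?_
    ((Nat.card B : K)⁻¹ • ∑ u, χ (-u) • ρ (c u)) ?_ ?_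
  · intro h hh x hx u
    rw [hmove h x hx, (hH h⁻¹).1 (H.inv_mem hh)]
  · let U : Subrepresentation ρ := ⟨⨆ g, W.map (ρ g), fun g x hx => by
      have hle : (⨆ g, W.map (ρ g)) ≤ (⨆ g, W.map (ρ g)).comap (ρ g) := by
        refine iSup_le fun g' => ?_
        rintro _ ⟨y, hy, rfl⟩
        refine Submodule.mem_iSup_of_mem (g * g') ⟨y, hy, ?_⟩
        rw [map_mul]; rfl
      exact hle hx⟩
    have hU : U = ⊤ := by
      refine (eq_bot_or_eq_top U).resolve_left fun h => hx₀ ?_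
      have hmem : x₀ ∈ U.toSubmodule := Submodule.mem_iSup_of_mem 1 ⟨x₀, hx₀χ, by simp⟩
      rw [h] at hmem
      exact hmem
    exact congrArg Subrepresentation.toSubmodule hU
  · intro x hx
    rw [LinearMap.smul_apply, LinearMap.sum_apply, Finset.sum_congr rfl (g := fun _ => x)]
    · rw [Finset.sum_const, Finset.card_univ, ← Nat.card_eq_fintype_card,
        ← Nat.cast_smul_eq_nsmul K, inv_smul_smul₀ hBK]
    · intro u _
      rw [LinearMap.smul_apply, hx u, smul_smul, ← AddChar.map_add_eq_mul, neg_add_cancel,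
        AddChar.map_zero_eq_one, one_smul]
  · intro g hg x hx
    let ψ : AddChar B K := χ.compAddMonoidHom (act g⁻¹) * χ⁻¹
    have hψ : ψ ≠ 0 := by
      intro h
      refine hg (inv_mem_iff.1 ((hH g⁻¹).2 fun u => ?_))
      have h1 : χ (act g⁻¹ u) * χ (-u) = 1 := DFunLike.congr_fun h u
      rw [AddChar.map_neg_eq_inv] at h1
      exact (mul_inv_eq_one₀ (χ.val_isUnit u).ne_zero).1 h1
    have hsum : ∑ u, ψ u = 0 := AddChar.sum_eq_zero_iff_ne_zero.2 hψ
    rw [LinearMap.smul_apply, LinearMap.sum_apply,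
      Finset.sum_congr rfl (g := fun u => ψ u • ρ g x), ← Finset.sum_smul, hsum, zero_smul,
      smul_zero]
    intro u _
    rw [LinearMap.smul_apply, hmove g x hx, smul_smul, mul_comm]
    rfl

end Clifford

/-! ### Characters of a principal left ideal of a finite ring -/

section TraceCharacter

variable {K : Type*} [Field K] {E : Type*} [Ring E]

/-- The character `χ` of `E` restricts to a non-degenerate trace form on `E x`, where `E x` is a
two-sided ideal. -/
structure IsTraceCharacter (x : E) (χ : AddChar E K) : Prop where
  mul_mem : ∀ t, ∃ s, x * t = s * x
  trace : ∀ s t, χ (s * t * x) = χ (t * s * x)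
  nondegenerate : ∀ w, (∀ s, χ (s * (w * x)) = 1) → w * x = 0

variable {x : E} {χ₀ : AddChar E K}

/-- Write x g⁻¹ = γx. The trace property turns invariance of the character under conjugation by g
into triviality of χ₀ on all s(gγ - 1)x, and non-degeneracy then gives g x g⁻¹ = x. -/
lemma IsTraceCharacter.stabilizer (h : IsTraceCharacter x χ₀) (g : Eˣ) :
    (∀ s, χ₀ (g * (s * x) * (g⁻¹ : Eˣ)) = χ₀ (s * x)) ↔ g * x = x * g := by
  constructor
  · intro hg
    obtain ⟨γ, hγ⟩ := h.mul_mem (g⁻¹ : Eˣ)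
    have hγ' : g * x * (g⁻¹ : Eˣ) = (g * γ : E) * x := by rw [mul_assoc, hγ, mul_assoc]
    have hzero : (g * γ - 1) * x = 0 := by
      refine h.nondegenerate _ fun s => ?_
      have h1 := hg ((g⁻¹ : Eˣ) * s * g)
      have h2 : (g * ((g⁻¹ : Eˣ) * s * g * x) * (g⁻¹ : Eˣ) : E) = s * ((g * γ : E) * x) := by
        rw [← hγ']
        simp only [mul_assoc, Units.mul_inv_cancel_left]
      have h3 : χ₀ (((g⁻¹ : Eˣ) * s : E) * g * x) = χ₀ (s * x) := by
        rw [h.trace, ← mul_assoc, Units.mul_inv, one_mul]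
      rw [h2, h3] at h1
      rw [sub_mul, one_mul, mul_sub, AddChar.map_sub_eq_div, h1,
        div_self (χ₀.val_isUnit _).ne_zero]
    rw [sub_mul, one_mul, sub_eq_zero, ← hγ'] at hzero
    exact (Units.mul_inv_eq_iff_eq_mul g).1 hzero
  · intro hg s
    have hx : x * (g⁻¹ : Eˣ) = (g⁻¹ : Eˣ) * x := by
      rw [Units.mul_inv_eq_iff_eq_mul, mul_assoc, ← hg, Units.inv_mul_cancel_left]
    have h1 : (g * (s * x) * (g⁻¹ : Eˣ) : E) = (g * s : E) * (g⁻¹ : Eˣ) * x := by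
      simp only [mul_assoc, hx]
    rw [h1, h.trace, ← mul_assoc, Units.inv_mul, one_mul]

variable [IsAlgClosed K] [CharZero K] [Finite E]

/-- Every character of a left ideal is a multiple of a non-degenerate one. -/
lemma exists_eq_mul_of_nondegenerate {I : Ideal E} (χ χ' : AddChar I K)
    (hχ : ∀ u : I, (∀ s : E, χ (s • u) = 1) → u = 0) : ∃ s : E, ∀ u : I, χ' u = χ (s • u) := by
  let B : Subgroup (AddChar I K) :=
    { carrier := {b | ∃ s : E, ∀ u : I, b u = χ (s • u)}
      one_mem' := ⟨0, fun u => by rw [zero_smul, AddChar.map_zero_eq_one]; rfl⟩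
      mul_mem' := by
        rintro b b' ⟨s, hs⟩ ⟨s', hs'⟩
        exact ⟨s + s', fun u => by rw [AddChar.mul_apply, hs, hs', add_smul,
          AddChar.map_add_eq_mul]⟩
      inv_mem' := by
        rintro b ⟨s, hs⟩
        exact ⟨-s, fun u => by rw [AddChar.inv_apply, hs, smul_neg, neg_smul]⟩ }
  have hB : B = ⊤ := eq_top_of_separates B fun u hu =>
    hχ u fun s => hu (χ.compAddMonoidHom (DistribSMul.toAddMonoidHom I s)) ⟨s, fun _ => rfl⟩
  have : χ' ∈ B := by rw [hB]; exact Subgroup.mem_top _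
  exact this

/-- If generators of `E x` are conjugate to `x`, then non-degenerate characters of `E x` are
conjugate. -/
lemma IsTraceCharacter.exists_conj (h : IsTraceCharacter x χ₀)
    (hconj : ∀ s s' : E, s * (s' * x) = x → ∃ g : Eˣ, g * x = s' * x * g)
    (χ : AddChar (Ideal.span {x}) K)
    (hχ : ∀ u : Ideal.span {x}, (∀ s : E, χ (s • u) = 1) → u = 0) :
    ∃ g : Eˣ, ∀ u : Ideal.span {x}, χ u = χ₀ (g * u * (g⁻¹ : Eˣ)) := by
  let χ₁ : AddChar (Ideal.span {x}) K :=
    χ₀.compAddMonoidHom (Ideal.span {x}).toAddSubgroup.subtype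
  have hχ₁ : ∀ u, χ₁ u = χ₀ u.1 := fun _ => rfl
  have hmem : ∀ u : Ideal.span {x}, ∃ w, u.1 = w * x := fun u => by
    obtain ⟨w, hw⟩ := Ideal.mem_span_singleton'.1 u.2
    exact ⟨w, hw.symm⟩
  have hχ₁nd : ∀ u : Ideal.span {x}, (∀ s : E, χ₁ (s • u) = 1) → u = 0 := by
    intro u hu
    obtain ⟨w, hw⟩ := hmem u
    apply Subtype.ext
    rw [hw]
    refine h.nondegenerate w fun s => ?_
    rw [← hw]
    exact hu s
  obtain ⟨s, hs⟩ := exists_eq_mul_of_nondegenerate χ₁ χ hχ₁nd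
  obtain ⟨s', hs'⟩ := exists_eq_mul_of_nondegenerate χ χ₁ hχ
  -- Each of the two non-degenerate characters is a multiple of the other, by s and s'. Trace
  -- symmetry moves ss' next to x, and non-degeneracy shows that it fixes x, so s'x is another
  -- generator of Ex.
  have hss : s * (s' * x) = x := by
    have h0 : (1 - s * s') * x = 0 := by
      refine h.nondegenerate _ fun t => ?_
      have hx : t * x ∈ Ideal.span {x} := Ideal.mul_mem_left _ _ (Ideal.mem_span_singleton_self x)
      have h1 := hs' ⟨t * x, hx⟩
      rw [hs] at h1
      have h1 : χ₀ (t * x) = χ₀ (s * (s' * (t * x))) := h1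
      have h2 : s * (s' * (t * x)) = (s * s') * t * x := by simp only [mul_assoc]
      rw [h2, h.trace] at h1
      rw [sub_mul, one_mul, mul_sub, AddChar.map_sub_eq_div, h1, mul_assoc,
        div_self (χ₀.val_isUnit _).ne_zero]
    rw [sub_mul, one_mul, sub_eq_zero, mul_assoc] at h0
    exact h0.symm
  obtain ⟨g, hg⟩ := hconj s s' hss
  refine ⟨g⁻¹, fun u => ?_⟩
  obtain ⟨w, hw⟩ := hmem u
  have h1 : x * g = (s * g : E) * x := by
    conv_lhs => rw [← hss]
    rw [mul_assoc s, ← hg, mul_assoc]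
  rw [hs, hχ₁, inv_inv, hw]
  change χ₀ (s * u.1) = _
  rw [hw]
  have h2 : ((g⁻¹ : Eˣ) * (w * x) * g : E) = ((g⁻¹ : Eˣ) * (w * s * g) : E) * x := by
    simp only [mul_assoc, h1]
  rw [h2, h.trace, ← mul_assoc, Units.mul_inv_cancel_right, h.trace]

end TraceCharacter

/-! ### The shift of a cycle -/

section Shift

variable {R : Type u} [Ring R] {ι : Type} {N : ι → Type v}
  [∀ i, AddCommGroup (N i)] [∀ i, Module R (N i)] {a : ι → ℕ}

namespace LongCycle

variable (c : LongCycle R N a)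

/-- The slot of `N_{v_p}` corresponding to a slot of `N_{v_{p+1}}`. -/
abbrev pred (p : Fin c.k) (s : Fin (a (c.v p.succ))) : Slot a :=
  ⟨c.v p.castSucc, Fin.cast (c.mult_eq p).symm s⟩

/-- The target slots of the shift. -/
abbrev tgt (p : Fin c.k) (s : Fin (a (c.v p.succ))) : Slot a := ⟨c.v p.succ, s⟩

lemma pred_injective (p : Fin c.k) : Function.Injective (c.pred p) := by
  intro s t h
  exact Fin.cast_injective _ (eq_of_heq (Sigma.mk.inj h).2)

lemma pred_ne_pred {p q : Fin c.k} (h : p ≠ q) (s : Fin (a (c.v p.succ)))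
    (t : Fin (a (c.v q.succ))) : c.pred p s ≠ c.pred q t := fun hst =>
  h (Fin.castSucc_injective _ (c.v_injective (congrArg Sigma.fst hst)))

lemma tgt_injective (p : Fin c.k) : Function.Injective (c.tgt p) := by
  intro s t h
  exact eq_of_heq (Sigma.mk.inj h).2

lemma tgt_ne_tgt {p q : Fin c.k} (h : p ≠ q) (s : Fin (a (c.v p.succ)))
    (t : Fin (a (c.v q.succ))) : c.tgt p s ≠ c.tgt q t := fun hst =>
  h (Fin.succ_injective _ (c.v_injective (congrArg Sigma.fst hst)))

lemma exists_eq_pred_or (y : Slot a) :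
    (∃ p t, y = c.pred p t) ∨ ∀ p : Fin c.k, y.1 ≠ c.v p.castSucc := by
  by_cases hy : ∃ p : Fin c.k, y.1 = c.v p.castSucc
  · obtain ⟨p, hp⟩ := hy
    obtain ⟨i, s⟩ := y
    have hp : i = c.v p.castSucc := hp
    subst hp
    exact Or.inl ⟨p, Fin.cast (c.mult_eq p) s, rfl⟩
  · exact Or.inr fun p hp => hy ⟨p, hp⟩

lemma exists_eq_tgt_or (y : Slot a) :
    (∃ p t, y = c.tgt p t) ∨ ∀ p : Fin c.k, y.1 ≠ c.v p.succ := by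
  by_cases hy : ∃ p : Fin c.k, y.1 = c.v p.succ
  · obtain ⟨p, hp⟩ := hy
    obtain ⟨i, s⟩ := y
    have hp : i = c.v p.succ := hp
    subst hp
    exact Or.inl ⟨p, s, rfl⟩
  · exact Or.inr fun p hp => hy ⟨p, hp⟩

lemma comp_f_eq_zero (p : Fin c.k) {k : ι} {g : N (c.v p.succ) →ₗ[R] N k}
    (hg : ¬ Function.Bijective g) (m : N (c.v p.castSucc)) : g (c.f p m) = 0 :=
  LinearMap.congr_fun ((c.isLeftMaximal p).2.2 k g hg) m

lemma f_apply_eq_of_not_bijective_sub (p : Fin c.k) {k : ι} {g g' : N (c.v p.succ) →ₗ[R] N k}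
    (hg : ¬ Function.Bijective (g - g')) (m : N (c.v p.castSucc)) : g (c.f p m) = g' (c.f p m) :=
  sub_eq_zero.1 (c.comp_f_eq_zero p hg m)

/-- A single arrow makes LM a line over the residue field; the scalar relative to `c.f p` is lifted
to an endomorphism. -/
lemma exists_eq_comp_f [∀ i, Finite (N i)] (hN : ∀ i, IsIndecomposable R (N i)) (p : Fin c.k)
    {h : N (c.v p.castSucc) →ₗ[R] N (c.v p.succ)}
    (hh : h ∈ LM R N (c.v p.castSucc) (c.v p.succ)) :
    ∃ e : Module.End R (N (c.v p.succ)), h = e ∘ₗ c.f p := by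
  let := residueDivisionRing (hN (c.v p.succ))
  have hone : Module.finrank (Residue R N (c.v p.succ))
      (LM R N (c.v p.castSucc) (c.v p.succ)) = 1 := by
    have := c.numArrows_eq_one p.castSucc
    rwa [Fin.coeSucc_eq_succ] at this
  have hf : c.f p ∈ LM R N (c.v p.castSucc) (c.v p.succ) :=
    Submodule.subset_span (c.isLeftMaximal p)
  have hf0 : (⟨c.f p, hf⟩ : LM R N (c.v p.castSucc) (c.v p.succ)) ≠ 0 := fun h0 =>
    (c.isLeftMaximal p).1 (congrArg Subtype.val h0)
  obtain ⟨e, he⟩ := (finrank_eq_one_iff_of_nonzero' _ hf0).1 hone ⟨h, hh⟩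
  obtain ⟨e, rfl⟩ := Ideal.Quotient.mk_surjective e
  exact ⟨e, (congrArg Subtype.val he).symm⟩

variable [DecidableEq ι]

lemma prj_shift (p : Fin c.k) (s : Fin (a (c.v p.succ))) (m : BigModule N a) :
    prj R N (c.tgt p s) (c.shift m) = c.f p (prj R N (c.pred p s) m) := by
  change (∑ q, blockMap (c.mult_eq q) (c.f q)) m (c.v p.succ) s =
    c.f p (m (c.v p.castSucc) (Fin.cast (c.mult_eq p).symm s))
  rw [LinearMap.sum_apply, Finset.sum_apply, Finset.sum_apply, Finset.sum_eq_single p]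
  · change (Pi.single (M := fun i => Fin (a i) → N i) (c.v p.succ) _) (c.v p.succ) s = _
    rw [Pi.single_eq_same]
    rfl
  · intro q _ hq
    change (Pi.single (M := fun i => Fin (a i) → N i) (c.v q.succ) _) (c.v p.succ) s = 0
    rw [Pi.single_eq_of_ne fun h => hq (Fin.succ_injective _ (c.v_injective h)).symm]
    rfl
  · simp

lemma prj_shift_of_ne {y : Slot a} (hy : ∀ p : Fin c.k, y.1 ≠ c.v p.succ) (m : BigModule N a) :
    prj R N y (c.shift m) = 0 := by
  change (∑ q, blockMap (c.mult_eq q) (c.f q)) m y.1 y.2 = 0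
  rw [LinearMap.sum_apply, Finset.sum_apply, Finset.sum_apply]
  refine Finset.sum_eq_zero fun q _ => ?_
  change (Pi.single (M := fun i => Fin (a i) → N i) (c.v q.succ) _) y.1 y.2 = 0
  rw [Pi.single_eq_of_ne (hy q)]
  rfl

lemma shift_inc (p : Fin c.k) (s : Fin (a (c.v p.succ))) (m : N (c.v p.castSucc)) :
    c.shift (inc R N (c.pred p s) m) = inc R N (c.tgt p s) (c.f p m) := by
  refine ext_prj (R := R) fun y => ?_
  rcases c.exists_eq_tgt_or y with ⟨q, t, rfl⟩ | hy
  · rw [prj_shift]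
    by_cases hpq : q = p
    · subst hpq
      by_cases hst : t = s
      · subst hst
        rw [prj_inc_apply_self (c.pred q t), prj_inc_apply_self (c.tgt q t)]
      · rw [prj_inc_apply_of_ne fun h => hst (c.pred_injective q h),
          prj_inc_apply_of_ne fun h => hst (c.tgt_injective q h), map_zero]
    · rw [prj_inc_apply_of_ne (c.pred_ne_pred hpq t s), prj_inc_apply_of_ne (c.tgt_ne_tgt hpq t s),
        map_zero]
  · rw [c.prj_shift_of_ne hy, prj_inc_apply_of_ne fun h => hy p (congrArg Sigma.fst h)]

lemma shift_inc_of_ne {y : Slot a} (hy : ∀ p : Fin c.k, y.1 ≠ c.v p.castSucc) (m : N y.1) :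
    c.shift (inc R N y m) = 0 := by
  refine ext_prj (R := R) fun z => ?_
  rw [map_zero]
  rcases c.exists_eq_tgt_or z with ⟨q, t, rfl⟩ | hz
  · rw [prj_shift, prj_inc_apply_of_ne fun h => hy q (congrArg Sigma.fst h).symm, map_zero]
  · rw [c.prj_shift_of_ne hz]

/-- An endomorphism with prescribed restrictions to the target slots. -/
lemma exists_end_tgt
    (φ : ∀ p : Fin c.k, Fin (a (c.v p.succ)) → N (c.v p.succ) →ₗ[R] BigModule N a) :
    ∃ s : Module.End R (BigModule N a), ∀ p t m, s (inc R N (c.tgt p t) m) = φ p t m := by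
  refine ⟨∑ p, ∑ t, φ p t ∘ₗ prj R N (c.tgt p t), fun p t m => ?_⟩
  rw [LinearMap.sum_apply, Finset.sum_eq_single p, LinearMap.sum_apply, Finset.sum_eq_single t]
  · rw [LinearMap.comp_apply, prj_inc_apply_self (c.tgt p t)]
  · intro t' _ ht'
    rw [LinearMap.comp_apply, prj_inc_apply_of_ne fun h => ht' (c.tgt_injective p h), map_zero]
  · simp
  · intro q _ hq
    rw [LinearMap.sum_apply]
    refine Finset.sum_eq_zero fun t' _ => ?_
    rw [LinearMap.comp_apply, prj_inc_apply_of_ne (c.tgt_ne_tgt hq t' t), map_zero]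
  · simp

variable [Fintype ι] [∀ i, Finite (N i)]

/-- Matrices with rows at `v_1, …, v_k` and entries in `LM` are left multiples of the shift. -/
lemma exists_eq_mul_shift (hN : ∀ i, IsIndecomposable R (N i))
    (hin : ∀ (p : Fin c.k) (j : ι), j ≠ c.v p.castSucc →
      ∀ f ∈ LM R N j (c.v p.succ), f = 0)
    (u : Module.End R (BigModule N a))
    (hrow : ∀ y : Slot a, (∀ p : Fin c.k, y.1 ≠ c.v p.succ) → prj R N y ∘ₗ u = 0)
    (hent : ∀ y z : Slot a, prj R N y ∘ₗ u ∘ₗ inc R N z ∈ LM R N z.1 y.1) :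
    ∃ s : Module.End R (BigModule N a), u = s * c.shift := by
  have hzero : ∀ (y z : Slot a), (∀ p : Fin c.k, y.1 = c.v p.succ → z.1 ≠ c.v p.castSucc) →
      ∀ m, prj R N y (u (inc R N z m)) = 0 := by
    intro y z hyz m
    rcases c.exists_eq_tgt_or y with ⟨p, t, rfl⟩ | hy
    · exact LinearMap.congr_fun (hin p z.1 (hyz p rfl) _ (hent (c.tgt p t) z)) m
    · exact LinearMap.congr_fun (hrow y hy) _
  have hex : ∀ (p : Fin c.k) (t : Fin (a (c.v p.succ))),
      ∃ φ : N (c.v p.succ) →ₗ[R] BigModule N a, ∀ m, u (inc R N (c.pred p t) m) = φ (c.f p m) := by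
    intro p t
    have h1 : ∀ y : Slot a, ∃ e : N (c.v p.succ) →ₗ[R] N y.1,
        ∀ m, prj R N y (u (inc R N (c.pred p t) m)) = e (c.f p m) := by
      intro y
      by_cases hy : y.1 = c.v p.succ
      · obtain ⟨i, s⟩ := y
        have hy : i = c.v p.succ := hy
        subst hy
        obtain ⟨e, he⟩ := c.exists_eq_comp_f hN p (hent (c.tgt p s) (c.pred p t))
        exact ⟨e, fun m => LinearMap.congr_fun he m⟩
      · refine ⟨0, hzero y (c.pred p t) fun q hq hq' => hy ?_⟩
        rw [hq, Fin.castSucc_injective _ (c.v_injective hq')]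
    choose e he using h1
    refine ⟨∑ y, inc R N y ∘ₗ e y, fun m => ?_⟩
    rw [← sum_inc_prj_apply (R := R) (u _), LinearMap.sum_apply]
    exact Finset.sum_congr rfl fun y _ => by rw [he]; rfl
  choose φ hφ using hex
  obtain ⟨s, hs⟩ := c.exists_end_tgt φ
  refine ⟨s, linearMap_ext_inc fun z => LinearMap.ext fun m => ?_⟩
  rw [LinearMap.comp_apply, LinearMap.comp_apply, Module.End.mul_apply]
  rcases c.exists_eq_pred_or z with ⟨p, t, rfl⟩ | hz
  · rw [hφ, shift_inc, hs]
  · rw [c.shift_inc_of_ne hz, map_zero]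
    refine ext_prj (R := R) fun y => ?_
    rw [hzero y z (fun p _ => hz p), map_zero]

/-- The left ideal generated by the shift is a two-sided ideal. -/
lemma exists_shift_mul_eq (hN : ∀ i, IsIndecomposable R (N i))
    (hin : ∀ (p : Fin c.k) (j : ι), j ≠ c.v p.castSucc →
      ∀ f ∈ LM R N j (c.v p.succ), f = 0)
    (t : Module.End R (BigModule N a)) :
    ∃ s : Module.End R (BigModule N a), c.shift * t = s * c.shift := by
  refine c.exists_eq_mul_shift hN hin _ ?_ ?_
  · intro y hy
    exact LinearMap.ext fun m => c.prj_shift_of_ne hy _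
  · intro y z
    rcases c.exists_eq_tgt_or y with ⟨p, s, rfl⟩ | hy
    · have h1 : prj R N (c.tgt p s) ∘ₗ (c.shift * t) ∘ₗ inc R N z =
          c.f p ∘ₗ (prj R N (c.pred p s) ∘ₗ t ∘ₗ inc R N z) :=
        LinearMap.ext fun m => c.prj_shift p s _
      rw [h1, mem_LM_iff hN]
      refine ⟨not_bijective_comp_left hN (c.isLeftMaximal p).2.1 _, fun k g hg => ?_⟩
      rw [← LinearMap.comp_assoc, (c.isLeftMaximal p).2.2 k g hg, LinearMap.zero_comp]
    · have h1 : prj R N y ∘ₗ (c.shift * t) ∘ₗ inc R N z = 0 :=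
        LinearMap.ext fun m => c.prj_shift_of_ne hy _
      rw [h1]
      exact zero_mem _

end LongCycle

end Shift

/-! ### The trace character of a cycle -/

section CycleCharacter

variable {R : Type u} [Ring R] {ι : Type} {N : ι → Type v}
  [∀ i, AddCommGroup (N i)] [∀ i, Module R (N i)] {a : ι → ℕ} [DecidableEq ι]

namespace LongCycle

variable (c : LongCycle R N a)

/-- The trace of the block from `N_{v_p}` to `N_{v_{p+1}}`. -/
def blockTrace (p : Fin c.k) :
    Module.End R (BigModule N a) →+ (N (c.v p.castSucc) →ₗ[R] N (c.v p.succ)) :=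
  AddMonoidHom.mk' (fun u => ∑ t, prj R N (c.tgt p t) ∘ₗ u ∘ₗ inc R N (c.pred p t)) fun u w => by
    rw [← Finset.sum_add_distrib]
    refine Finset.sum_congr rfl fun t _ => ?_
    rw [LinearMap.add_comp, LinearMap.comp_add]

lemma blockTrace_apply (p : Fin c.k) (u : Module.End R (BigModule N a)) (m : N (c.v p.castSucc)) :
    c.blockTrace p u m = ∑ t, prj R N (c.tgt p t) (u (inc R N (c.pred p t) m)) :=
  LinearMap.sum_apply _ _ _

lemma prj_apply_inc_f_eq_zero (hne : ∀ i j, i ≠ j → IsEmpty (N i ≃ₗ[R] N j)) (p : Fin c.k)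
    {y : Slot a} (hy : y.1 ≠ c.v p.succ) (w : Module.End R (BigModule N a))
    (t : Fin (a (c.v p.succ))) (m : N (c.v p.castSucc)) :
    prj R N y (w (inc R N (c.tgt p t) (c.f p m))) = 0 :=
  c.comp_f_eq_zero p (g := prj R N y ∘ₗ w ∘ₗ inc R N (c.tgt p t))
    (fun hb => (hne _ _ hy.symm).false (LinearEquiv.ofBijective _ hb)) m

variable [Fintype ι]

/-- Maps from N_{v_{p+1}} to non-isomorphic summands kill f_p, so on the image of f_p an
endomorphism acts as a matrix within one vertex. This makes the trace computations blockwise. -/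
lemma apply_inc_f_eq_sum (hne : ∀ i j, i ≠ j → IsEmpty (N i ≃ₗ[R] N j)) (p : Fin c.k)
    (w : Module.End R (BigModule N a)) (t : Fin (a (c.v p.succ))) (m : N (c.v p.castSucc)) :
    w (inc R N (c.tgt p t) (c.f p m)) =
      ∑ t', inc R N (c.tgt p t') (prj R N (c.tgt p t') (w (inc R N (c.tgt p t) (c.f p m)))) := by
  conv_lhs => rw [← sum_inc_prj_apply (R := R) (w _)]
  rw [Fintype.sum_sigma, Finset.sum_eq_single (c.v p.succ)]
  · intro i _ hi
    refine Finset.sum_eq_zero fun s _ => ?_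
    rw [c.prj_apply_inc_f_eq_zero hne p (y := ⟨i, s⟩) hi, map_zero]
  · simp

/-- Tr(sw) = Tr(ws) for matrices over the residue field, which is commutative by Wedderburn. The
entrywise commutators lie in the radical and are killed by f_p. -/
lemma blockTrace_mul_comm [∀ i, Finite (N i)] (hN : ∀ i, IsIndecomposable R (N i))
    (hne : ∀ i j, i ≠ j → IsEmpty (N i ≃ₗ[R] N j)) (p : Fin c.k)
    (s w : Module.End R (BigModule N a)) :
    c.blockTrace p (s * w * c.shift) = c.blockTrace p (w * s * c.shift) := by
  have key : ∀ s w : Module.End R (BigModule N a), ∀ m, c.blockTrace p (s * w * c.shift) m =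
      ∑ t, ∑ t', (prj R N (c.tgt p t) ∘ₗ s ∘ₗ inc R N (c.tgt p t'))
        ((prj R N (c.tgt p t') ∘ₗ w ∘ₗ inc R N (c.tgt p t)) (c.f p m)) := by
    intro s w m
    rw [blockTrace_apply]
    refine Finset.sum_congr rfl fun t _ => ?_
    rw [Module.End.mul_apply, shift_inc, Module.End.mul_apply, c.apply_inc_f_eq_sum hne p w,
      map_sum, map_sum]
    rfl
  refine LinearMap.ext fun m => ?_
  rw [key, key, Finset.sum_comm]
  refine Finset.sum_congr rfl fun t _ => Finset.sum_congr rfl fun t' _ => ?_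
  exact c.f_apply_eq_of_not_bijective_sub p (not_bijective_commutator (hN (c.v p.succ))
    (prj R N (c.tgt p t') ∘ₗ s ∘ₗ inc R N (c.tgt p t))
    (prj R N (c.tgt p t) ∘ₗ w ∘ₗ inc R N (c.tgt p t'))) m

/-- A multiple of the shift is zero as soon as no left multiple of it has block traces
`(0, …, f_p, …, 0)`. -/
lemma mul_shift_eq_zero (hne : ∀ i j, i ≠ j → IsEmpty (N i ≃ₗ[R] N j))
    (w : Module.End R (BigModule N a))
    (h : ∀ (s : Module.End R (BigModule N a)) (p : Fin c.k),
      ¬ (c.blockTrace p (s * (w * c.shift)) = c.f p ∧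
        ∀ q ≠ p, c.blockTrace q (s * (w * c.shift)) = 0)) : w * c.shift = 0 := by
  refine linearMap_ext_inc fun z => LinearMap.ext fun m => ?_
  change w (c.shift (inc R N z m)) = 0
  rcases c.exists_eq_pred_or z with ⟨p, t, rfl⟩ | hz
  swap
  · rw [c.shift_inc_of_ne hz, map_zero]
  rw [shift_inc]
  refine ext_prj (R := R) fun y => ?_
  rw [map_zero]
  by_cases hy : y.1 = c.v p.succ
  swap
  · exact c.prj_apply_inc_f_eq_zero hne p hy w t m
  obtain ⟨i, t₀⟩ := y
  have hy : i = c.v p.succ := hy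
  subst hy
  -- A non-bijective entry kills f_p. A bijective one can be inverted and moved to the diagonal by a
  -- left factor, producing exactly the excluded block traces.
  by_cases hb : Function.Bijective (prj R N (c.tgt p t₀) ∘ₗ w ∘ₗ inc R N (c.tgt p t))
  swap
  · exact c.comp_f_eq_zero p hb m
  let e := LinearEquiv.ofBijective _ hb
  refine absurd ⟨?_, ?_⟩ (h (inc R N (c.tgt p t) ∘ₗ e.symm.toLinearMap ∘ₗ prj R N (c.tgt p t₀)) p)
  · refine LinearMap.ext fun m => ?_
    rw [blockTrace_apply, Finset.sum_eq_single t]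
    · change prj R N (c.tgt p t) (inc R N (c.tgt p t) (e.symm (prj R N (c.tgt p t₀)
        (w (c.shift (inc R N (c.pred p t) m)))))) = _
      rw [prj_inc_apply_self (c.tgt p t), shift_inc]
      exact e.symm_apply_apply _
    · intro t' _ ht'
      exact prj_inc_apply_of_ne (fun h => ht' (c.tgt_injective p h)) _
    · simp
  · intro q hq
    refine LinearMap.ext fun m => ?_
    rw [blockTrace_apply]
    exact Finset.sum_eq_zero fun t' _ => prj_inc_apply_of_ne (c.tgt_ne_tgt hq t' t) _

variable (K : Type*) [Field K] [IsAlgClosed K] [CharZero K]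

/-- For each p choose a character of Hom(N_{v_p}, N_{v_{p+1}}) that is non-trivial at f_p, and
compose it with the block trace. The product over p is the analogue of a trace form on a product of
matrix algebras. -/
lemma exists_isTraceCharacter [∀ i, Finite (N i)] (hN : ∀ i, IsIndecomposable R (N i))
    (hne : ∀ i j, i ≠ j → IsEmpty (N i ≃ₗ[R] N j))
    (hin : ∀ (p : Fin c.k) (j : ι), j ≠ c.v p.castSucc →
      ∀ f ∈ LM R N j (c.v p.succ), f = 0) :
    ∃ χ : AddChar (Module.End R (BigModule N a)) K, IsTraceCharacter c.shift χ := by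
  choose ψ hψ using fun p => exists_addChar_ne_one K (c.isLeftMaximal p).1
  let χ : AddChar (Module.End R (BigModule N a)) K :=
    ∏ p, (ψ p).compAddMonoidHom (c.blockTrace p)
  have hχ : ∀ u, χ u = ∏ p, ψ p (c.blockTrace p u) := fun u => AddChar.prod_apply _ _ _
  refine ⟨χ, c.exists_shift_mul_eq hN hin, fun s t => ?_, fun w hw => ?_⟩
  · rw [hχ, hχ]
    exact Finset.prod_congr rfl fun p _ => by rw [c.blockTrace_mul_comm hN hne]
  · refine c.mul_shift_eq_zero hne w ?_
    rintro s p ⟨h1, h2⟩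
    have h3 := hw s
    rw [hχ, Finset.prod_eq_single p, h1] at h3
    · exact hψ p h3
    · intro q _ hq
      rw [h2 q hq, AddChar.map_zero_eq_one]
    · simp

end LongCycle

end CycleCharacter

/-! ### Generators of the ideal of the shift are conjugate -/

section Conjugate

variable {R : Type u} [Ring R] {ι : Type} {N : ι → Type v}
  [∀ i, AddCommGroup (N i)] [∀ i, Module R (N i)] {a : ι → ℕ} [DecidableEq ι]

variable (R N a) in
/-- The projection of `⨁ᵢ Nᵢ ^ aᵢ` to the summand `Nᵢ ^ aᵢ`, as an endomorphism. -/
def vertexProj (i : ι) : Module.End R (BigModule N a) :=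
  LinearMap.single R (fun i => Fin (a i) → N i) i ∘ₗ LinearMap.proj i

lemma vertexProj_inc_same {i : ι} (s : Fin (a i)) (m : N i) :
    vertexProj R N a i (inc R N ⟨i, s⟩ m) = inc R N ⟨i, s⟩ m := by
  simp [vertexProj, inc]

lemma vertexProj_inc_of_ne {i : ι} {y : Slot a} (hy : y.1 ≠ i) (m : N y.1) :
    vertexProj R N a i (inc R N y m) = 0 := by
  simp [vertexProj, inc, Pi.single_eq_of_ne hy.symm]

namespace LongCycle

variable (c : LongCycle R N a) [Fintype ι] [∀ i, Finite (N i)]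

/-- Truncate s and s' to the block at v_{p+1} and extend by the identity; call the results h₁ and
h₂. The product h₁h₂ fixes the image of f_p ≠ 0 in every slot there, so no entry of 1 - h₁h₂ is
injective at that vertex, and the other columns vanish. Hence h₁h₂ is bijective, and h₁ is a unit by
finiteness. -/
lemma exists_unit_map_shift (hN : ∀ i, IsIndecomposable R (N i))
    (hne : ∀ i j, i ≠ j → IsEmpty (N i ≃ₗ[R] N j)) {s s' : Module.End R (BigModule N a)}
    (hs : s * (s' * c.shift) = c.shift) (p : Fin c.k) :
    ∃ g : (Module.End R (BigModule N a))ˣ,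
      (∀ y : Slot a, y.1 ≠ c.v p.succ → ∀ m, g.1 (inc R N y m) = inc R N y m) ∧
      ∀ t m, g.1 ((s' * c.shift) (inc R N (c.pred p t) m)) = c.shift (inc R N (c.pred p t) m) := by
  have hnt := fun i => (hN i).1
  let e := vertexProj R N a (c.v p.succ)
  let h₁ : Module.End R (BigModule N a) := 1 - e + e * s * e
  let h₂ : Module.End R (BigModule N a) := 1 - e + e * s' * e
  have heX : ∀ t m, e (c.shift (inc R N (c.pred p t) m)) = c.shift (inc R N (c.pred p t) m) := by
    intro t m
    rw [shift_inc]
    exact vertexProj_inc_same t _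
  have heY : ∀ t m, e (s' (c.shift (inc R N (c.pred p t) m))) =
      s' (c.shift (inc R N (c.pred p t) m)) := by
    intro t m
    rw [shift_inc, c.apply_inc_f_eq_sum hne p s', map_sum]
    exact Finset.sum_congr rfl fun t' _ => vertexProj_inc_same t' _
  have hsY : ∀ n, s (s' (c.shift n)) = c.shift n := fun n => LinearMap.congr_fun hs n
  have h₁Y : ∀ t m, h₁ (s' (c.shift (inc R N (c.pred p t) m))) =
      c.shift (inc R N (c.pred p t) m) := by
    intro t m
    change _ - e _ + e (s (e _)) = _
    rw [heY, hsY, heX, Module.End.one_apply, sub_self, zero_add]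
  have h₂X : ∀ t m, h₂ (c.shift (inc R N (c.pred p t) m)) =
      s' (c.shift (inc R N (c.pred p t) m)) := by
    intro t m
    change _ - e _ + e (s' (e _)) = _
    rw [heX, heY, Module.End.one_apply, sub_self, zero_add]
  have hfix : ∀ (b : Module.End R (BigModule N a)) (y : Slot a), y.1 ≠ c.v p.succ → ∀ m,
      (1 - e + e * b * e) (inc R N y m) = inc R N y m := by
    intro b y hy m
    change inc R N y m - e _ + e (b (e _)) = _
    rw [vertexProj_inc_of_ne hy, map_zero, map_zero, sub_zero, add_zero]
  have hbij : Function.Bijective (1 - (1 - h₁ * h₂) : Module.End R (BigModule N a)) := by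
    refine bijective_one_sub_of_entries hN _ fun y z hb => ?_
    by_cases hz : z.1 = c.v p.succ
    · obtain ⟨i, t⟩ := z
      have hz : i = c.v p.succ := hz
      subst hz
      refine (c.isLeftMaximal p).1 (LinearMap.ext fun m => hb.1 ?_)
      change prj R N y (inc R N (c.tgt p t) (c.f p m) - h₁ (h₂ (inc R N (c.tgt p t) (c.f p m)))) = _
      rw [← shift_inc, h₂X, h₁Y, sub_self, map_zero, LinearMap.zero_apply, map_zero]
    · refine not_bijective_zero (R := R) (X := N z.1) (Y := N y.1) ?_
      convert hb using 2
      refine LinearMap.ext fun m => ?_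
      change 0 = prj R N y (inc R N z m - h₁ (h₂ (inc R N z m)))
      rw [hfix s' z hz, hfix s z hz, sub_self, map_zero]
  rw [sub_sub_cancel] at hbij
  have hsurj : Function.Surjective h₁ := Function.Surjective.of_comp (g := h₂) hbij.2
  have hunit : IsUnit h₁ := (Module.End.isUnit_iff h₁).2 (Finite.surjective_iff_bijective.1 hsurj)
  exact ⟨hunit.unit, hfix s, h₁Y⟩

/-- The generator s'x is conjugated to x one arrow at a time. Correcting arrow m changes the basis
only at v_{m+1}, which is neither the source nor the target of an earlier arrow. Around a closed
cycle the last correction would disturb the first arrow, which is why the shift omits the closing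
one. -/
lemma exists_conj_shift (hN : ∀ i, IsIndecomposable R (N i))
    (hne : ∀ i j, i ≠ j → IsEmpty (N i ≃ₗ[R] N j))
    (hin : ∀ (p : Fin c.k) (j : ι), j ≠ c.v p.castSucc →
      ∀ f ∈ LM R N j (c.v p.succ), f = 0)
    (s s' : Module.End R (BigModule N a)) (hs : s * (s' * c.shift) = c.shift) :
    ∃ g : (Module.End R (BigModule N a))ˣ, g * c.shift = s' * c.shift * g := by
  have hmove : ∀ g : (Module.End R (BigModule N a))ˣ, ∃ r r' : Module.End R (BigModule N a),
      g * (s' * c.shift) * (g⁻¹ : (Module.End R (BigModule N a))ˣ) = r' * c.shift ∧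
      r * (r' * c.shift) = c.shift := by
    intro g
    -- Two-sidedness of the ideal shows that a conjugate of a generator is again of the form r'x
    -- with r r'x = x, so the induction can continue.
    obtain ⟨b, hb⟩ := c.exists_shift_mul_eq hN hin (g⁻¹ : (Module.End R (BigModule N a))ˣ)
    obtain ⟨b', hb'⟩ := c.exists_shift_mul_eq hN hin g
    have h1 : g * (s' * c.shift) * (g⁻¹ : (Module.End R (BigModule N a))ˣ) =
        g * s' * b * c.shift := by simp only [mul_assoc, hb]
    refine ⟨b' * s * (g⁻¹ : (Module.End R (BigModule N a))ˣ), g * s' * b, h1, ?_⟩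
    rw [← h1]
    simp only [mul_assoc, Units.inv_mul_cancel_left]
    rw [← mul_assoc s' c.shift, ← mul_assoc s, hs, ← mul_assoc, ← hb', mul_assoc, Units.mul_inv,
      mul_one]
  have key : ∀ m ≤ c.k, ∃ g : (Module.End R (BigModule N a))ˣ, ∀ q : Fin c.k, q.val < m →
      ∀ t n, (g * (s' * c.shift) * (g⁻¹ : (Module.End R (BigModule N a))ˣ) :
        Module.End R (BigModule N a)) (inc R N (c.pred q t) n) =
          c.shift (inc R N (c.pred q t) n) := by
    intro m
    induction m with
    | zero => exact fun _ => ⟨1, fun q hq => absurd hq (Nat.not_lt_zero _)⟩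
    | succ m ih =>
      intro hm
      obtain ⟨g, hg⟩ := ih (Nat.le_of_succ_le hm)
      obtain ⟨r, r', hr', hr⟩ := hmove g
      obtain ⟨g', hfix, hmap⟩ := c.exists_unit_map_shift hN hne hr ⟨m, hm⟩
      refine ⟨g' * g, fun q hq t n => ?_⟩
      have hinv : ((g'⁻¹ : (Module.End R (BigModule N a))ˣ) : Module.End R (BigModule N a))
          (inc R N (c.pred q t) n) = inc R N (c.pred q t) n := by
        have h1 := hfix (c.pred q t) (fun h => by
          have := congrArg Fin.val (c.v_injective h)
          simp only [Fin.val_castSucc, Fin.val_succ] at this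
          omega) n
        conv_lhs => rw [← h1]
        exact LinearMap.congr_fun g'.inv_mul _
      have hcalc : ((g' * g : (Module.End R (BigModule N a))ˣ) * (s' * c.shift) *
          ((g' * g)⁻¹ : (Module.End R (BigModule N a))ˣ) : Module.End R (BigModule N a)) =
          g' * (r' * c.shift) * (g'⁻¹ : (Module.End R (BigModule N a))ˣ) := by
        rw [← hr', mul_inv_rev, Units.val_mul, Units.val_mul]
        simp only [mul_assoc]
      rw [hcalc, Module.End.mul_apply, hinv, Module.End.mul_apply]
      rcases Nat.lt_succ_iff_lt_or_eq.1 hq with hlt | heq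
      · rw [← hr', hg q hlt, shift_inc]
        refine hfix (c.tgt q t) (fun h => ?_) _
        have := congrArg Fin.val (c.v_injective h)
        simp only [Fin.val_succ] at this
        omega
      · have hq' : q = ⟨m, hm⟩ := Fin.ext heq
        subst hq'
        exact hmap t n
  obtain ⟨g, hg⟩ := key c.k le_rfl
  obtain ⟨r, r', hr', -⟩ := hmove g
  have hfin : (g * (s' * c.shift) * (g⁻¹ : (Module.End R (BigModule N a))ˣ) :
      Module.End R (BigModule N a)) = c.shift := by
    refine linearMap_ext_inc fun z => LinearMap.ext fun n => ?_
    rcases c.exists_eq_pred_or z with ⟨p, t, rfl⟩ | hz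
    · exact hg p p.2 t n
    · rw [hr']
      change r' (c.shift (inc R N z n)) = c.shift (inc R N z n)
      rw [c.shift_inc_of_ne hz, map_zero]
  refine ⟨g⁻¹, ?_⟩
  rw [Units.inv_mul_eq_iff_eq_mul, ← mul_assoc, ← mul_assoc]
  rw [← mul_assoc] at hfin
  exact hfin.symm

end LongCycle

end Conjugate

/-! ### Automorphisms of the module over the auxiliary ring -/

section TildeAut

variable {R : Type u} [Ring R] {X : Type v} [AddCommGroup X] [Module R X]

/-- The automorphisms commuting with an endomorphism `t`. -/
def autCentralizer (t : X →ₗ[R] X) : Subgroup (X ≃ₗ[R] X) where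
  carrier := {g | ∀ m, g (t m) = t (g m)}
  one_mem' _ := rfl
  mul_mem' {g h} hg hh m := by
    rw [LinearEquiv.mul_apply, LinearEquiv.mul_apply, hh, hg]
  inv_mem' {g} hg m := by
    apply g.injective
    rw [hg]
    exact (g.apply_symm_apply _).trans (congrArg t (g.apply_symm_apply m).symm)

variable (t : X →ₗ[R] X) (ht : t ∘ₗ t = 0)

/-- R̃ is generated by R and x, so an additive map commuting with both commutes with every element.
-/
lemma tildeHom_comm (φ : X →+ X) (hR : ∀ (r : R) m, φ (r • m) = r • φ m)
    (hφ : ∀ m, φ (t m) = t (φ m)) (z : RTilde R) (m : X) :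
    φ (tildeHom t ht z m) = tildeHom t ht z (φ m) := by
  have h1 : ∀ w : FreeBimodule R, φ (bimoduleAct t w m) = bimoduleAct t w (φ m) := by
    intro w
    induction w using FreeBimodule.induction with
    | h0 => simp
    | hm b₁ b₂ => rw [bimoduleAct_mk, bimoduleAct_mk, hR, hφ, hR]
    | ha y z hy hz =>
      rw [map_add]
      change φ (bimoduleAct t y m + bimoduleAct t z m) =
        bimoduleAct t y (φ m) + bimoduleAct t z (φ m)
      rw [map_add, hy, hz]
  change φ (z.fst • m + bimoduleAct t z.snd m) = z.fst • φ m + bimoduleAct t z.snd (φ m)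
  rw [map_add, hR, h1]

lemma tildeHom_inl (r : R) (m : X) : tildeHom t ht (TrivSqZeroExt.inl r) m = r • m := by
  change r • m + bimoduleAct t 0 m = r • m
  rw [map_zero]
  exact add_zero _

lemma tildeHom_inr (m : X) :
    tildeHom t ht (TrivSqZeroExt.inr (FreeBimodule.mk 1 1)) m = t m := by
  change (0 : R) • m + bimoduleAct t (FreeBimodule.mk 1 1) m = t m
  rw [bimoduleAct_mk, zero_smul, zero_add, one_smul, one_smul]

lemma comm_of_tildeHom_comm (φ : X → X)
    (h : ∀ z m, φ (tildeHom t ht z m) = tildeHom t ht z (φ m)) :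
    (∀ (r : R) m, φ (r • m) = r • φ m) ∧ ∀ m, φ (t m) = t (φ m) := by
  refine ⟨fun r m => ?_, fun m => ?_⟩
  · rw [← tildeHom_inl t ht, h, tildeHom_inl]
  · rw [← tildeHom_inr t ht, h, tildeHom_inr]

/-- The automorphisms of the module on which `x` acts as `t` are those commuting with `t`. -/
def autCentralizerEquiv :
    autCentralizer t ≃* (TildeModule t ht ≃ₗ[RTilde R] TildeModule t ht) where
  toFun g :=
    { toFun := fun m => g.1 m
      map_add' := fun m m' => map_add g.1 m m'
      map_smul' := fun z m =>
        tildeHom_comm t ht (g.1 : X →+ X) (fun r m => map_smul g.1 r m) g.2 z m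
      invFun := fun m => g.1.symm m
      left_inv := g.1.symm_apply_apply
      right_inv := g.1.apply_symm_apply }
  invFun φ :=
    ⟨{ toFun := fun m => φ m
       map_add' := fun m m' => φ.map_add m m'
       map_smul' := (comm_of_tildeHom_comm t ht φ φ.map_smul).1
       invFun := fun m => φ.symm m
       left_inv := φ.symm_apply_apply
       right_inv := φ.apply_symm_apply }, (comm_of_tildeHom_comm t ht φ φ.map_smul).2⟩
  left_inv _ := rfl
  right_inv _ := rfl
  map_mul' _ _ := rfl

end TildeAut

/-! ### Induction from the centralizer of the shift -/

section CycleInduction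

variable {A : Type w} [CommRing A] {R : Type u} [Ring R] [Algebra A R]
  {ι : Type} {N : ι → Type v} [∀ i, AddCommGroup (N i)] [∀ i, Module R (N i)] {a : ι → ℕ}
  [∀ i, Finite (N i)]

/-- Lifts a residue different from 0 and 1; it supplies a non-trivial scaling when the multiplicity
is one. -/
lemma exists_bijective_sub_one (hN : ∀ i, IsIndecomposable R (N i)) (j : ι)
    (hcard : Nat.card (Residue R N j) ≠ 2) :
    ∃ e : Module.End R (N j), Function.Bijective e ∧
      Function.Bijective (e - 1 : Module.End R (N j)) := by
  let := residueDivisionRing (hN j)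
  obtain ⟨r, hr0, hr1⟩ : ∃ r : Residue R N j, r ≠ 0 ∧ r ≠ 1 := by
    by_contra! hcon
    refine hcard (Nat.card_eq_two_iff.2 ⟨0, 1, zero_ne_one, ?_⟩)
    ext r
    simp only [Set.mem_insert_iff, Set.mem_singleton_iff, Set.mem_univ, iff_true]
    exact or_iff_not_imp_left.2 (hcon r)
  obtain ⟨e, rfl⟩ := Ideal.Quotient.mk_surjective r
  refine ⟨e, ?_, ?_⟩
  · by_contra h
    exact hr0 (Ideal.Quotient.eq_zero_iff_mem.2 ((mem_jacobson_end_iff (hN j)).2 h))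
  · by_contra h
    refine hr1 (Ideal.Quotient.eq.2 ((mem_jacobson_end_iff (hN j)).2 h))

variable [DecidableEq ι] (c : LongCycle R N a)

/-- At v₀ there is an automorphism 1 + u whose part u has a single entry d, with d bijective: a
transvection if a > 1, a scaling otherwise. The shift never lands in v₀, so u ∘ x = 0; commuting
would give x ∘ u = 0 and hence f₀ = 0. -/
lemma LongCycle.autCentralizer_shift_ne_top (hN : ∀ i, IsIndecomposable R (N i))
    (ha : ∀ i, 0 < a i)
    (h : ¬ (a (c.v 0) = 1 ∧ Nat.card (Residue R N (c.v 0)) = 2)) :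
    autCentralizer c.shift ≠ ⊤ := by
  let p : Fin c.k := ⟨0, c.one_le_k⟩
  have hp : p.castSucc = 0 := rfl
  rw [← hp] at h
  obtain ⟨s, t, d, hd, hunit⟩ : ∃ (s t : Fin (a (c.v p.castSucc)))
      (d : Module.End R (N (c.v p.castSucc))), Function.Bijective d ∧
        IsUnit (1 + inc R N ⟨c.v p.castSucc, s⟩ ∘ₗ d ∘ₗ prj R N ⟨c.v p.castSucc, t⟩ :
          Module.End R (BigModule N a)) := by
    have hpos := ha (c.v p.castSucc)
    by_cases h1 : a (c.v p.castSucc) = 1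
    · obtain ⟨e, he, he1⟩ := exists_bijective_sub_one hN _ fun h2 => h ⟨h1, h2⟩
      obtain ⟨e', rfl⟩ := (Module.End.isUnit_iff e).2 he
      have key : ∀ f f' : Module.End R (N (c.v p.castSucc)), f * f' = 1 →
          (1 + inc R N ⟨c.v p.castSucc, ⟨0, hpos⟩⟩ ∘ₗ (f - 1) ∘ₗ
            prj R N ⟨c.v p.castSucc, ⟨0, hpos⟩⟩ : Module.End R (BigModule N a)) *
          (1 + inc R N ⟨c.v p.castSucc, ⟨0, hpos⟩⟩ ∘ₗ (f' - 1) ∘ₗ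
            prj R N ⟨c.v p.castSucc, ⟨0, hpos⟩⟩ : Module.End R (BigModule N a)) = 1 := by
        intro f f' hff
        have hff' : ∀ n, f (f' n) = n := fun n => LinearMap.congr_fun hff n
        refine LinearMap.ext fun m => ?_
        simp only [Module.End.mul_apply, LinearMap.add_apply, Module.End.one_apply,
          LinearMap.comp_apply, map_add, LinearMap.sub_apply, map_sub,
          prj_inc_apply_self (R := R) (N := N) (⟨c.v p.castSucc, ⟨0, hpos⟩⟩ : Slot a), hff']
        abel
      exact ⟨⟨0, hpos⟩, ⟨0, hpos⟩, e' - 1, he1,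
        ⟨⟨_, _, key e' _ e'.mul_inv, key _ e' e'.inv_mul⟩, rfl⟩⟩
    · have hlt : 1 < a (c.v p.castSucc) := by omega
      refine ⟨⟨0, hpos⟩, ⟨1, hlt⟩, 1, Function.bijective_id, IsNilpotent.isUnit_one_add ⟨2, ?_⟩⟩
      rw [sq]
      refine LinearMap.ext fun m => ?_
      change inc R N ⟨c.v p.castSucc, ⟨0, hpos⟩⟩ (prj R N ⟨c.v p.castSucc, ⟨1, hlt⟩⟩
        (inc R N ⟨c.v p.castSucc, ⟨0, hpos⟩⟩ (prj R N ⟨c.v p.castSucc, ⟨1, hlt⟩⟩ m))) = 0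
      rw [prj_inc_apply_of_ne (fun h => by simp at h), map_zero]
  obtain ⟨g, hg⟩ := hunit
  intro htop
  have hmem : LinearMap.GeneralLinearGroup.generalLinearEquiv R (BigModule N a) g ∈
      autCentralizer c.shift := by rw [htop]; exact Subgroup.mem_top _
  have hcomm : ∀ m, g.1 (c.shift m) = c.shift (g.1 m) := hmem
  rw [hg] at hcomm
  have hzero : ∀ m, c.shift (inc R N ⟨c.v p.castSucc, s⟩
      (d (prj R N ⟨c.v p.castSucc, t⟩ m))) = 0 := by
    intro m
    have h1 := hcomm m
    simp only [LinearMap.add_apply, Module.End.one_apply, LinearMap.comp_apply, map_add,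
      add_right_inj] at h1
    rw [← h1, c.prj_shift_of_ne (y := ⟨c.v p.castSucc, t⟩) (fun q hq => Fin.succ_ne_zero q
      (c.v_injective hq).symm), map_zero, map_zero]
  refine (c.isLeftMaximal p).1 (LinearMap.ext fun n => ?_)
  obtain ⟨n', rfl⟩ := hd.2 n
  have h2 := hzero (inc R N ⟨c.v p.castSucc, t⟩ n')
  rw [prj_inc_apply_self (⟨c.v p.castSucc, t⟩ : Slot a)] at h2
  have h3 := c.shift_inc p (Fin.cast (c.mult_eq p) s) (d n')
  exact inc_injective (R := R) (c.tgt p _) ((h3.symm.trans h2).trans (map_zero _).symm)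

variable [Fintype ι] {K : Type*} [Field K] [IsAlgClosed K] [CharZero K] {V : Type*}
  [AddCommGroup V] [Module K V] {ρ : Representation K (BigModule N a ≃ₗ[R] BigModule N a) V}

/-- Clifford theory for 1 + Ex. Since (Ex)² = 0, the map u ↦ 1 + u is a homomorphism from the
additive group, with conjugation as the action. -/
lemma LongCycle.isInducedFrom_autCentralizer [Nontrivial V] (hirr : ρ.IsIrreducible)
    (hρ : AvoidsProperQuotients A ρ) (hN : ∀ i, IsIndecomposable R (N i))
    (hne : ∀ i j, i ≠ j → IsEmpty (N i ≃ₗ[R] N j))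
    (hin : ∀ (p : Fin c.k) (j : ι), j ≠ c.v p.castSucc →
      ∀ f ∈ LM R N j (c.v p.succ), f = 0) : IsInducedFrom ρ (autCentralizer c.shift) := by
  obtain ⟨χ₀, hχ₀⟩ := c.exists_isTraceCharacter K hN hne hin
  let I : Ideal (Module.End R (BigModule N a)) := Ideal.span {c.shift}
  let toG := LinearMap.GeneralLinearGroup.generalLinearEquiv R (BigModule N a)
  have hI : ∀ u ∈ I, ∃ s, u = s * c.shift := fun u hu => by
    obtain ⟨w, hw⟩ := Ideal.mem_span_singleton'.1 hu
    exact ⟨w, hw.symm⟩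
  have hsq : c.shift * c.shift = 0 := c.shift_comp_shift
  have hmul0 : ∀ u ∈ I, ∀ w ∈ I, u * w = 0 := by
    intro u hu w hw
    obtain ⟨s, rfl⟩ := hI u hu
    obtain ⟨s', rfl⟩ := hI w hw
    obtain ⟨b, hb⟩ := hχ₀.mul_mem s'
    rw [mul_assoc, ← mul_assoc c.shift, hb, mul_assoc b, hsq, mul_zero, mul_zero]
  let cU : I → (Module.End R (BigModule N a))ˣ := fun u =>
    ⟨1 + u.1, 1 - u.1,
      by rw [mul_sub, add_mul, add_mul, one_mul, mul_one, hmul0 u u.2 u u.2]; simp,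
      by rw [sub_mul, mul_add, mul_add, one_mul, mul_one, hmul0 u u.2 u u.2]; simp⟩
  have hcU : ∀ u w, cU (u + w) = cU u * cU w := by
    intro u w
    ext1
    change 1 + (u.1 + w.1) = (1 + u.1) * (1 + w.1)
    rw [add_mul, mul_add, mul_add, one_mul, mul_one, hmul0 u u.2 w w.2, one_mul]
    abel
  have hconj : ∀ (g : (Module.End R (BigModule N a))ˣ), ∀ u ∈ I,
      g * u * (g⁻¹ : (Module.End R (BigModule N a))ˣ) ∈ I := by
    intro g u hu
    obtain ⟨s, rfl⟩ := hI u hu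
    obtain ⟨b, hb⟩ := hχ₀.mul_mem (g⁻¹ : (Module.End R (BigModule N a))ˣ)
    rw [mul_assoc, mul_assoc s, hb, ← mul_assoc, ← mul_assoc]
    exact I.mul_mem_left _ (Ideal.mem_span_singleton_self _)
  let actU : (Module.End R (BigModule N a))ˣ → I →+ I := fun g =>
    AddMonoidHom.mk' (fun u => ⟨_, hconj g u.1 u.2⟩) fun u w => Subtype.ext (by
      change g * (u.1 + w.1) * (g⁻¹ : (Module.End R (BigModule N a))ˣ) = _ * _ * _ + _ * _ * _
      rw [mul_add, add_mul])
  have hactU : ∀ g u, cU (actU g u) = g * cU u * g⁻¹ := by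
    intro g u
    ext1
    change 1 + g * u.1 * (g⁻¹ : (Module.End R (BigModule N a))ˣ) =
      g * (1 + u.1) * (g⁻¹ : (Module.End R (BigModule N a))ˣ)
    rw [mul_add, mul_one, add_mul, Units.mul_inv]
  let cG : I → (BigModule N a ≃ₗ[R] BigModule N a) := fun u => toG (cU u)
  have hcG : ∀ u w, cG (u + w) = cG u * cG w := fun u w => by
    simp only [cG, hcU, map_mul]
  obtain ⟨χ, x₀, hx₀, hχ⟩ := exists_addChar_eigenvector (K := K) (ρ := ρ) cG hcG
  have hnondeg : ∀ u : I, (∀ s : Module.End R (BigModule N a), χ (s • u) = 1) → u = 0 := by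
    intro u hu
    by_contra hu0
    have hle : Ideal.span {u.1} ≤ I := (Ideal.span_singleton_le_iff_mem I).2 u.2
    -- If χ were trivial on the left ideal Eu, the eigenvector x₀ would be fixed by 1 + Eu.
    refine hx₀ (eq_zero_of_fixed_by_one_add_ideal hρ (L := Ideal.span {u.1}) ?_ ?_ x₀ ?_)
    · rw [Ne, Ideal.span_singleton_eq_bot]
      exact fun h => hu0 (Subtype.ext h)
    · intro l hl
      exact (Module.End.isUnit_iff _).1 (cU ⟨l, hle hl⟩).isUnit
    · intro g hg
      obtain ⟨s, hs⟩ := Ideal.mem_span_singleton'.1 hg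
      have h1 : g = cG (s • u) := by
        refine LinearEquiv.ext fun m => ?_
        change g m = (1 + s * u.1 : Module.End R (BigModule N a)) m
        rw [hs, add_sub_cancel]
        rfl
      rw [h1, hχ, hu, one_smul]
  obtain ⟨g, hg⟩ := hχ₀.exists_conj (c.exists_conj_shift hN hne hin) χ hnondeg
  have : Finite (BigModule N a ≃ₗ[R] BigModule N a) :=
    Finite.of_injective (fun g => (g : BigModule N a → BigModule N a)) DFunLike.coe_injective
  -- Translating the eigenvector by g replaces χ by its conjugate χ₀, whose stabilizer is known.
  refine isInducedFrom_of_addChar hirr cG (fun g => actU (toG.symm g)) (fun g u => ?_)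
    (χ₀.compAddMonoidHom I.toAddSubgroup.subtype) _ (fun g => ?_) (x₀ := ρ (toG g) x₀) ?_ ?_
  · simp only [cG, hactU, map_mul, map_inv, MulEquiv.apply_symm_apply]
  · have hst := hχ₀.stabilizer (toG.symm g)
    have hcomm : g ∈ autCentralizer c.shift ↔
        ((toG.symm g : (Module.End R (BigModule N a))ˣ) : Module.End R (BigModule N a)) * c.shift =
          c.shift * (toG.symm g : (Module.End R (BigModule N a))ˣ) :=
      ⟨fun h => LinearMap.ext h, fun h m => LinearMap.congr_fun h m⟩
    rw [hcomm, ← hst]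
    constructor
    · rintro h ⟨u, hu⟩
      obtain ⟨s, rfl⟩ := hI u hu
      exact h s
    · intro h s
      exact h ⟨s * c.shift, I.mul_mem_left _ (Ideal.mem_span_singleton_self _)⟩
  · intro h0
    apply hx₀
    have h1 := congrArg (ρ (toG g)⁻¹) h0
    rwa [map_zero, ← Module.End.mul_apply, ← map_mul, inv_mul_cancel, map_one] at h1
  · intro u
    have h1 : cG u * toG g = toG g * cG (actU g⁻¹ u) := by
      simp only [cG, hactU, map_mul, map_inv, inv_inv]
      group
    rw [← Module.End.mul_apply, ← map_mul, h1, map_mul, Module.End.mul_apply, hχ, map_smul, hg]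
    congr 1
    change χ₀ (g * ((g⁻¹ : (Module.End R (BigModule N a))ˣ) * u.1 *
      (g⁻¹⁻¹ : (Module.End R (BigModule N a))ˣ)) *
      (g⁻¹ : (Module.End R (BigModule N a))ˣ)) = χ₀ u.1
    rw [inv_inv, mul_assoc, mul_assoc, mul_assoc, Units.mul_inv, mul_one, Units.mul_inv_cancel_left]

end CycleInduction

/-! ### Cycles of a permutation as cycles of the left maximal graph -/

/-- The cycle is the orbit of j up to its minimal period k + 1. Minimality gives distinct vertices,
and periodicity gives the closing arrow, where p + 1 wraps to 0. -/
lemma exists_longCycle_of_perm {R : Type u} [Ring R] {ι : Type} [Finite ι] [DecidableEq ι]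
    {N : ι → Type v} [∀ i, AddCommGroup (N i)] [∀ i, Module R (N i)] [∀ i, Finite (N i)]
    {a : ι → ℕ} (hN : ∀ i, IsIndecomposable R (N i)) (s : Equiv.Perm ι)
    (hs : ∀ j, numArrows R N j (s j) = 1) (has : ∀ j, a (s j) = a j) {j : ι} (hj : s j ≠ j) :
    ∃ c : LongCycle R N a, c.v 0 = j ∧ ∀ p : Fin c.k, c.v p.succ = s (c.v p.castSucc) := by
  have hper : j ∈ Function.periodicPts s := s.injective.mem_periodicPts j
  have hpos := Function.minimalPeriod_pos_of_mem_periodicPts hper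
  have hne1 : Function.minimalPeriod s j ≠ 1 := fun h =>
    hj (Function.minimalPeriod_eq_one_iff_isFixedPt.1 h)
  obtain ⟨k, hk⟩ : ∃ k, Function.minimalPeriod s j = k + 1 := ⟨_, (Nat.sub_add_cancel hpos).symm⟩
  let v : Fin (k + 1) → ι := fun p => s^[p] j
  have hsucc : ∀ p : Fin k, v p.succ = s (v p.castSucc) := fun p =>
    Function.iterate_succ_apply' s p j
  have hadd : ∀ p : Fin (k + 1), v (p + 1) = s (v p) := by
    intro p
    induction p using Fin.lastCases with
    | last =>
      rw [Fin.last_add_one]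
      change j = s (s^[k] j)
      rw [← Function.iterate_succ_apply' s, Nat.succ_eq_add_one, ← hk,
        Function.iterate_minimalPeriod]
    | cast p => rw [Fin.coeSucc_eq_succ, hsucc]
  have hf : ∀ p : Fin k, ∃ f : N (v p.castSucc) →ₗ[R] N (v p.succ), IsLeftMaximal N f := by
    intro p
    have h1 : numArrows R N (v p.castSucc) (v p.succ) ≠ 0 := by rw [hsucc, hs]; exact one_ne_zero
    obtain ⟨f, hf, hf0⟩ := (numArrows_ne_zero_iff hN).1 h1
    exact ⟨f, isLeftMaximal_of_mem_LM hN hf hf0⟩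
  choose f hf using hf
  refine ⟨⟨k, by omega, v, fun p q hpq => ?_, fun p => by rw [hadd, hs], f, hf,
    fun p => by rw [hsucc, has]⟩, rfl, hsucc⟩
  have hmem : ∀ p : Fin (k + 1), (p : ℕ) ∈ Set.Iio (Function.minimalPeriod s j) := fun p => by
    rw [hk]; exact p.2
  exact Fin.ext (Function.iterate_injOn_Iio_minimalPeriod (hmem p) (hmem q) hpq)

end

end FunctorMorphing

/-! ### The trichotomy: split automorphism group, induction along a cycle, or loops -/

open FunctorMorphing in
theorem theoremD {𝒪 : Type*} [CommRing 𝒪] [IsDomain 𝒪] [IsDiscreteValuationRing 𝒪]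
    [IsAdicComplete (IsLocalRing.maximalIdeal 𝒪) 𝒪] [Finite (IsLocalRing.ResidueField 𝒪)] (ℓ : ℕ)
    {R : Type*} [Ring R] [Finite R] [Algebra (𝒪 ⧸ IsLocalRing.maximalIdeal 𝒪 ^ ℓ) R]
    {n : ℕ} (N : Fin n → Type*) [∀ i, AddCommGroup (N i)] [∀ i, Module R (N i)]
    [∀ i, Finite (N i)] (hindec : ∀ i, IsIndecomposable R (N i))
    (hnoniso : ∀ i j, i ≠ j → IsEmpty (N i ≃ₗ[R] N j))
    (a : Fin n → ℕ) (ha : ∀ i, 0 < a i)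
    {K : Type*} [Field K] [IsAlgClosed K] [CharZero K]
    {V : Type*} [AddCommGroup V] [Module K V]
    (ρ : Representation K (BigModule N a ≃ₗ[R] BigModule N a) V) (hirr : ρ.IsIrreducible)
    (htriv : HasTrivialMorphing (𝒪 ⧸ IsLocalRing.maximalIdeal 𝒪 ^ ℓ) ρ)
    -- `M` is not a power of a single indecomposable module whose endomorphism ring is a field
    (hfield : n = 1 → ∀ i, ∃ φ : Module.End R (N i), φ ≠ 0 ∧ ¬ Function.Bijective φ)
    -- if some arrow joins distinct vertices, then one of these has source `j` with `GL_{a_j}(E_j) ≠ 1`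
    (htwo : (∃ j i, j ≠ i ∧ numArrows R N j i ≠ 0) →
      ∃ j i, j ≠ i ∧ numArrows R N j i ≠ 0 ∧ ¬ (a j = 1 ∧ Nat.card (Residue R N j) = 2)) :
    AutSplits R (BigModule N a) ∨
    (∃ (c : LongCycle R N a) (H : Subgroup (BigModule N a ≃ₗ[R] BigModule N a)),
      H ≠ ⊤ ∧ Nonempty (H ≃* (c.MTilde ≃ₗ[RTilde R] c.MTilde)) ∧ IsInducedFrom ρ H) ∨
    IsUnionOfLoops R N := by
  obtain ⟨_, _, ⟨⟨_, hρ⟩, _⟩⟩ := htriv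
  replace hρ : AvoidsProperQuotients (𝒪 ⧸ IsLocalRing.maximalIdeal 𝒪 ^ ℓ) ρ := hρ
  have : Nontrivial V := by
    by_contra hV
    rw [not_nontrivial_iff_subsingleton] at hV
    have := hirr.toNontrivial
    exact bot_ne_top (α := Subrepresentation ρ)
      (Subrepresentation.toSubmodule_injective (Subsingleton.elim _ _))
  -- A vertex with no outgoing radical morphism is isolated from all others, so it splits off unless
  -- it is the only vertex; in that case its endomorphism ring would contradict `hfield`.
  by_cases hspecial : ∃ i, ∀ k (g : N i →ₗ[R] N k), ¬ Function.Bijective g → g = 0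
  · obtain ⟨i, hi⟩ := hspecial
    by_cases hj : ∃ j, i ≠ j
    · obtain ⟨j, hij⟩ := hj
      exact Or.inl (autSplits_of_hom_eq_zero hindec ha hij
        (fun k hk f => hi k f fun hf => (hnoniso i k hk.symm).false (LinearEquiv.ofBijective f hf))
        fun k hk f => eq_zero_of_hom_out_eq_zero hρ hindec hnoniso ha hk hi f)
    · push Not at hj
      have h1 : n = 1 := by
        have : Unique (Fin n) := ⟨⟨i⟩, fun j => (hj j).symm⟩
        rw [← Fintype.card_fin n, Fintype.card_unique]
      obtain ⟨φ, h0, hφ⟩ := hfield h1 i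
      exact absurd (hi i φ hφ) h0
  · push Not at hspecial
    obtain ⟨s, hs, has⟩ := exists_perm_of_sum_le (numArrows R N) a ha
      (sum_numArrows_mul_le hρ hindec hnoniso ha) fun j => by
        obtain ⟨k, g, hg, hg0⟩ := hspecial j
        exact exists_numArrows_ne_zero hindec hg0 hg
    have hs1 : ∀ j, numArrows R N j (s j) = 1 := fun j => by rw [hs, if_pos rfl]
    right
    by_cases hfix : ∀ j, s j = j
    · refine Or.inr ⟨fun i => ?_, fun j i hji => ?_⟩
      · rw [hs, if_pos (hfix i).symm]
      · rw [hs, hfix, if_neg hji.symm]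
    · left
      push Not at hfix
      obtain ⟨j₀, hj₀⟩ := hfix
      -- The cycle is started at the source of the arrow given by `htwo`, so that the size condition
      -- holds at v₀, where properness of the centralizer is tested.
      obtain ⟨j, i, hji, hne, hsize⟩ := htwo ⟨j₀, s j₀, hj₀.symm, by rw [hs1]; exact one_ne_zero⟩
      have his : i = s j := by
        by_contra h
        exact hne (by rw [hs, if_neg h])
      obtain ⟨c, hc0, hc⟩ := exists_longCycle_of_perm hindec s hs1 has (his ▸ hji.symm)
      have hin : ∀ (p : Fin c.k) j, j ≠ c.v p.castSucc →
          ∀ f ∈ LM R N j (c.v p.succ), f = 0 := by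
        intro p j hj f hf
        by_contra hf0
        have h1 := (numArrows_ne_zero_iff hindec).2 ⟨f, hf, hf0⟩
        rw [hs, hc, if_neg (s.injective.ne hj.symm)] at h1
        exact h1 rfl
      exact ⟨c, autCentralizer c.shift, c.autCentralizer_shift_ne_top hindec ha (hc0 ▸ hsize),
        ⟨autCentralizerEquiv c.shift c.shift_comp_shift⟩,
        c.isInducedFrom_autCentralizer hirr hρ hindec hnoniso hin⟩
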